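/- Let $2^{\omega}$ be Cantor space; its elements are called reals. For a finite binary string $\sigma$ let $N_\sigma\subseteq 2^{\omega}$ be the set of reals extending $\sigma$. Let $\mu$ be a Borel probability measure on $2^{\omega}$. The \emph{rational representation} of $\mu$ is the real that codes the set of all triples $\langle\sigma,q_1,q_2\rangle$, with $\sigma$ a finite binary string and $q_1,q_2\in\mathbb{Q}$, such that $q_1<\mu(N_\sigma)<q_2$. A \emph{Cauchy representation} of $\mu$ is a real that codes (the graph of) a function $f$ with $f(\sigma,n)\in\{0,1,\dots,2^n\}$ and $|f(\sigma,n)/2^n-\mu(N_\sigma)|\le 2^{-n}$ for all finite binary strings $\sigma$ and all $n\in\mathbb{N}$. If $\rho\in 2^{\omega}$ is a representation of $\mu$, then a real $x$ is \emph{$\mu$-random with respect to $\rho$} if $x\notin\bigcap_n\bigcup_{\sigma\in W_n}N_\sigma$ for every set $W\subseteq\mathbb{N}\times 2^{<\omega}$ that is recursively enumerable in $\rho$ and satisfies $\sum_{\sigma\in W_n}\mu(N_\sigma)\le 2^{-n}$ for all $n$, where $W_n=\{\sigma:(n,\sigma)\in W\}$. **Theorem.** Fix either of the two kinds of representation, rational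 or Cauchy. For every real $x\in 2^{\omega}$ the following are equivalent: (i) there are a Borel probability measure $\mu$ on $2^{\omega}$ and a representation $\rho$ of $\mu$ of the chosen kind such that $\mu(\{x\})=0$ and $x$ is $\mu$-random with respect to $\rho$; (ii) $x$ is not recursive. -/

import Mathlib

open MeasureTheory

/-- The Cantor space of infinite binary sequences (called reals), with its product topology and
product `σ`-algebra, which is the Borel `σ`-algebra. -/
abbrev Cantor : Type := ℕ → Bool

/-- The cylinder `N_σ = {x : x↾|σ| = σ}` of a finite binary sequence `σ`. -/
def cyl (σ : List Bool) : Set Cantor :=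
  {x | (List.range σ.length).map x = σ}

/-- The open set `N_U`, the union of the cylinders of the members of `U`. -/
def openOf (U : Set (List Bool)) : Set Cantor :=
  ⋃ σ ∈ U, cyl σ

/-- The real `z` as a (total) oracle with values in `{0, 1}`. -/
def oracleOf (z : Cantor) : ℕ →. ℕ :=
  fun n => Part.some (z n).toNat

/-- `W ⊆ ℕ × 2^{<ω}` is recursively enumerable in `z`: it is the domain of a partial function
that is recursive in `z` (this is Mathlib's `REPred` with an oracle). -/
def IsREIn (z : Cantor) (W : Set (ℕ × List Bool)) : Prop :=
  RecursiveIn {oracleOf z}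
    (fun p : ℕ × List Bool => Part.assert (p ∈ W) fun _ => Part.some ())

/-- The section `W_n = {σ : (n, σ) ∈ W}`. -/
def testSection (W : Set (ℕ × List Bool)) (n : ℕ) : Set (List Bool) :=
  {σ | (n, σ) ∈ W}

/-- `W` is correct for `μ`: `∑_{σ ∈ W_n} μ(N_σ) ≤ 2^{-n}` for all `n`. -/
def IsCorrectFor (μ : Measure Cantor) (W : Set (ℕ × List Bool)) : Prop :=
  ∀ n : ℕ, ∑' σ : testSection W n, μ (cyl σ.1) ≤ (2 : ENNReal)⁻¹ ^ n

/-- `x` passes the test `W`: `x ∉ ⋂_n N_{W_n}`. -/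
def Passes (x : Cantor) (W : Set (ℕ × List Bool)) : Prop :=
  x ∉ ⋂ n : ℕ, openOf (testSection W n)

/-- `x` is Martin-Löf random for `μ` with respect to the representation `ρ` of `μ`: it passes all
tests recursively enumerable in `ρ` that are correct for `μ`. -/
def IsRandomFor (ρ : Cantor) (μ : Measure Cantor) (x : Cantor) : Prop :=
  ∀ W : Set (ℕ × List Bool), IsREIn ρ W → IsCorrectFor μ W → Passes x W

/-- The rational number `a / (b + 1)` given by the pair `(a, b)`. -/
def ratOf (p : ℤ × ℕ) : ℚ :=
  (p.1 : ℚ) / ((p.2 : ℚ) + 1)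

/-- `ρ` is the rational representation of `μ`: the set of (the codes of) all triples
`⟨σ, q₁, q₂⟩` with `q₁ < μ(N_σ) < q₂`. -/
def IsRationalRepresentation (ρ : Cantor) (μ : Measure Cantor) : Prop :=
  ∀ m : ℕ, ρ m = true ↔
    ∃ (σ : List Bool) (q₁ q₂ : ℤ × ℕ), m = Encodable.encode (σ, q₁, q₂) ∧
      (ratOf q₁ : ℝ) < μ.real (cyl σ) ∧ μ.real (cyl σ) < (ratOf q₂ : ℝ)

/-- `ρ` is a Cauchy representation of `μ` (for the weak topology): it is the set of codes of a
function `f` that approximates each `μ(N_σ)` by dyadic rationals `f(σ, n) / 2^n ∈ [0, 1]` with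
error at most `2^{-n}`. The numerators are bounded, so the representations of all
probability measures form a `Π⁰₁` subset of Cantor space that is mapped onto the space of
probability measures. -/
def IsCauchyRepresentation (ρ : Cantor) (μ : Measure Cantor) : Prop :=
  ∃ f : List Bool → ℕ → ℕ,
    (∀ σ n, f σ n ≤ 2 ^ n ∧ |(f σ n : ℝ) / 2 ^ n - μ.real (cyl σ)| ≤ 1 / 2 ^ n) ∧
    ∀ m : ℕ, ρ m = true ↔ ∃ (σ : List Bool) (n : ℕ), m = Encodable.encode (σ, n, f σ n)

/-! Suppose that x is computable and μ{x} = 0. Then the measures of the cylinders around x tend to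
0, and a representation allows a search for an initial segment whose cylinder has measure at most
2⁻ⁿ. The cylinders found form a test that x fails (`not_isRandomFor_of_search`).

Suppose that x is not computable. The desired measure is approximated by lists `ev w` of equally
weighted strings. An operation duplicates the list and moves strings forward, differently in the two
copies. Measures are named by tables of natural numbers giving values with denominator 4^(|σ|+1),
and only finitely many tables of each length matter. `Cons` ties a table to a list. A cylinder
carries at least half of the weight that has entered it, so cylinders of total measure at most 2⁻ⁿ
contain at most a proportion 2·2⁻ⁿ of the list. It carries at most half of the weight that may still
enter it, plus an error that vanishes with the length, so x gets measure 0 if the weight that can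
reach its initial segments is halved again and again.

The invariant is `Forces`: whatever operations are later carried out above the current initial
segment u of x, some consistent table leaves at least 1/N of the whole list above u and uncovered by
the tests treated so far. A new test at a level n with 4N ≤ 2ⁿ costs a factor 2
(`Forces.or_covered`). To halve the weight, the list is split at some initial segment of x beyond u.
Either the invariant survives on the side of x, or it fails on the other side, and then a finite
witness of this failure pushes the good strings to the side of x (`Forces.split`). If neither ever
happened, the next bit of x would always be the side on which the invariant fails. Failure is
witnessed by a finite search, so x would be computable (`exists_split`).

A limit of the tables names μ (`exists_generic`). A test enumerable in a real computed from the name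
depends continuously on the name (`exists_functional`), hence is among the tests treated. Since the
values of μ are exact dyadic fractions, representations of both kinds are computed from the name. -/

/-! ### Splitting operations and the lists of strings they produce. -/

/-- A pair of strings towards which the members of a list of strings are moved. -/
abbrev Op : Type := List Bool × List Bool

/-- Move the string `y` to `v` if `v` extends it. -/
def rep (v y : List Bool) : List Bool :=
  if y <+: v then v else y

/-- Duplicate a list of strings, moving the first copy towards `o.1` and the second one towards
`o.2`. -/
def step (g : List (List Bool)) (o : Op) : List (List Bool) :=
  g.map (rep o.1) ++ g.map (rep o.2)

/-- The list of strings obtained from the empty string by a sequence of operations. -/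
def ev (w : List Op) : List (List Bool) :=
  w.foldl step [[]]

/-- Two strings are comparable if one of them extends the other. -/
def Comp (y σ : List Bool) : Prop :=
  y <+: σ ∨ σ <+: y

instance (y σ : List Bool) : Decidable (Comp y σ) :=
  inferInstanceAs (Decidable (_ ∨ _))

/-- The number of members of `ev w` that extend `σ`. -/
def lo (w : List Op) (σ : List Bool) : ℕ :=
  (ev w).countP fun y => σ <+: y

/-- The number of members of `ev w` that are comparable to `σ`. -/
def hi (w : List Op) (σ : List Bool) : ℕ :=
  (ev w).countP fun y => Comp y σ

/-- The sequence of operations `t` carried out above the string `u`. -/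
def above (u : List Bool) (t : List Op) : List Op :=
  t.map fun o => (u ++ o.1, u ++ o.2)

theorem Comp.symm {y σ : List Bool} (h : Comp y σ) : Comp σ y := Or.symm h

theorem comp_of_prefix {a b c : List Bool} (h₁ : a <+: c) (h₂ : b <+: c) : Comp a b :=
  List.prefix_or_prefix_of_prefix h₁ h₂

theorem prefix_rep (v y : List Bool) : y <+: rep v y := by
  unfold rep; split_ifs with h
  · exact h
  · exact List.prefix_refl y

theorem rep_eq_or (v y : List Bool) : rep v y = y ∨ rep v y = v := by
  unfold rep; split_ifs <;> simp

theorem ev_nil : ev [] = [[]] := rfl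

theorem ev_append_singleton (w : List Op) (o : Op) : ev (w ++ [o]) = step (ev w) o := by
  simp [ev]

theorem length_ev (w : List Op) : (ev w).length = 2 ^ w.length := by
  induction w using List.reverseRecOn with
  | nil => rfl
  | append_singleton w o ih =>
    rw [ev_append_singleton, step]; simp [ih, pow_succ]; ring

theorem countP_ev_append_singleton (w : List Op) (o : Op) (p : List Bool → Bool) :
    (ev (w ++ [o])).countP p =
      (ev w).countP (p ∘ rep o.1) + (ev w).countP (p ∘ rep o.2) := by
  rw [ev_append_singleton, step, List.countP_append, List.countP_map, List.countP_map]

/-- Along operations that do not lose the property `p`, the proportion of strings having the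
property does not decrease. -/
theorem le_countP_ev_append (w t : List Op) (p : List Bool → Bool)
    (h : ∀ o ∈ t, ∀ y, p y → p (rep o.1 y) ∧ p (rep o.2 y)) :
    2 ^ t.length * (ev w).countP p ≤ (ev (w ++ t)).countP p := by
  induction t using List.reverseRecOn with
  | nil => simp
  | append_singleton t o ih =>
    have h₁ := ih fun o' ho' => h o' (by simp [ho'])
    have h₂ := h o (by simp)
    rw [← List.append_assoc, countP_ev_append_singleton]
    have e₁ : (ev (w ++ t)).countP p ≤ (ev (w ++ t)).countP (p ∘ rep o.1) :=
      List.countP_mono_left fun y _ hy => (h₂ y hy).1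
    have e₂ : (ev (w ++ t)).countP p ≤ (ev (w ++ t)).countP (p ∘ rep o.2) :=
      List.countP_mono_left fun y _ hy => (h₂ y hy).2
    rw [List.length_append, List.length_singleton, pow_succ]
    linarith

/-- Along operations that do not create the property `p`, the proportion of strings having the
property does not increase. -/
theorem countP_ev_append_le (w t : List Op) (p : List Bool → Bool)
    (h : ∀ o ∈ t, ∀ y, (p (rep o.1 y) → p y) ∧ (p (rep o.2 y) → p y)) :
    (ev (w ++ t)).countP p ≤ 2 ^ t.length * (ev w).countP p := by
  induction t using List.reverseRecOn with
  | nil => simp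
  | append_singleton t o ih =>
    have h₁ := ih fun o' ho' => h o' (by simp [ho'])
    have h₂ := h o (by simp)
    rw [← List.append_assoc, countP_ev_append_singleton]
    have e₁ : (ev (w ++ t)).countP (p ∘ rep o.1) ≤ (ev (w ++ t)).countP p :=
      List.countP_mono_left fun y _ hy => (h₂ y).1 hy
    have e₂ : (ev (w ++ t)).countP (p ∘ rep o.2) ≤ (ev (w ++ t)).countP p :=
      List.countP_mono_left fun y _ hy => (h₂ y).2 hy
    rw [List.length_append, List.length_singleton, pow_succ]
    linarith

/-- A string that has entered a cylinder never leaves it. Together with `hi_append_le`, this makes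
the interval between the proportions of `lo` and `hi` shrink as operations are added. -/
theorem le_lo_append (w t : List Op) (σ : List Bool) :
    2 ^ t.length * lo w σ ≤ lo (w ++ t) σ := by
  refine le_countP_ev_append w t _ fun o _ y hy => ?_
  simp only [decide_eq_true_eq] at hy ⊢
  exact ⟨hy.trans (prefix_rep _ _), hy.trans (prefix_rep _ _)⟩

theorem comp_of_comp_rep {v y σ : List Bool} (h : Comp (rep v y) σ) : Comp y σ := by
  rcases h with h | h
  · exact Or.inl ((prefix_rep v y).trans h)
  · exact comp_of_prefix (prefix_rep v y) h

theorem hi_append_le (w t : List Op) (σ : List Bool) :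
    hi (w ++ t) σ ≤ 2 ^ t.length * hi w σ := by
  refine countP_ev_append_le w t _ fun o _ y => ?_
  simp only [decide_eq_true_eq]
  exact ⟨comp_of_comp_rep, comp_of_comp_rep⟩

/-! ### Focused strings, and the independence of operations above incomparable strings. -/

/-- The only member of `ev w` that is comparable to `u` is `u`. -/
def Focused (w : List Op) (u : List Bool) : Prop :=
  ∀ y ∈ ev w, Comp y u → y = u

theorem prefix_rep_above_iff {v v' a y : List Bool} (h : ¬ Comp v v') :
    v <+: rep (v' ++ a) y ↔ v <+: y := by
  refine ⟨fun hv => ?_, fun hv => hv.trans (prefix_rep _ _)⟩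
  rcases rep_eq_or (v' ++ a) y with e | e
  · rwa [e] at hv
  · rw [e] at hv
    exact (h (comp_of_prefix hv (List.prefix_append v' a))).elim

theorem rep_above_eq {v v' a y : List Bool} (h : ¬ Comp v v') (hy : v <+: y) :
    rep (v' ++ a) y = y := by
  rcases rep_eq_or (v' ++ a) y with e | e
  · exact e
  · have hv := (prefix_rep_above_iff (a := a) h).2 hy
    rw [e] at hv
    exact (h (comp_of_prefix hv (List.prefix_append v' a))).elim

theorem comp_rep_above {v v' a y : List Bool} (h : ¬ Comp v v')
    (hy : Comp (rep (v' ++ a) y) v) : rep (v' ++ a) y = y := by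
  rcases rep_eq_or (v' ++ a) y with e | e
  · exact e
  · rw [e] at hy
    refine (h ?_).elim
    rcases hy with hy | hy
    · exact Or.inr ((List.prefix_append v' a).trans hy)
    · exact comp_of_prefix hy (List.prefix_append v' a)

/-- Operations above `v'` do not change the part of the list above an incomparable string. -/
theorem countP_above {v v' : List Bool} (h : ¬ Comp v v') (w t : List Op)
    (q : List Bool → Prop) [DecidablePred q] :
    (ev (w ++ above v' t)).countP (fun y => v <+: y ∧ q y) =
      2 ^ t.length * (ev w).countP (fun y => v <+: y ∧ q y) := by
  have key : ∀ a y, (v <+: rep (v' ++ a) y ∧ q (rep (v' ++ a) y)) ↔ (v <+: y ∧ q y) := by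
    intro a y
    rw [prefix_rep_above_iff h]
    exact and_congr_right fun hy => by rw [rep_above_eq h hy]
  have hl : (above v' t).length = t.length := by simp [above]
  rw [← hl]
  refine le_antisymm (countP_ev_append_le _ _ _ fun o ho y => ?_)
    (le_countP_ev_append _ _ _ fun o ho y => ?_)
  all_goals
    obtain ⟨p, -, rfl⟩ := List.mem_map.1 ho
    simp only [decide_eq_true_eq, key]
    tauto

/-- Strings moved by these operations end up above `v'`, hence incomparable to `v`. -/
theorem Focused.above {v v' : List Bool} (h : ¬ Comp v v') {w : List Op} (hw : Focused w v)
    (t : List Op) : Focused (w ++ above v' t) v := by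
  induction t using List.reverseRecOn with
  | nil => simpa [_root_.above] using hw
  | append_singleton t o ih =>
    intro y hy hc
    simp only [_root_.above, List.map_append, List.map_cons, List.map_nil] at hy
    rw [← List.append_assoc, ev_append_singleton, step, List.mem_append, List.mem_map,
      List.mem_map] at hy
    rcases hy with ⟨y', hy', rfl⟩ | ⟨y', hy', rfl⟩
    all_goals
      have e := comp_rep_above h hc
      rw [e] at hc ⊢
      exact ih y' hy' hc

theorem not_comp_siblings (τ : List Bool) (b : Bool) : ¬ Comp (τ ++ [b]) (τ ++ [!b]) := by
  rintro (h | h)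
  all_goals
    have := h.eq_of_length (by simp)
    simp at this

/-- All strings comparable to `u` are equal to `u`, so the first copy of them moves to one child of
`τ` and the second copy to the other. Hence the count at one child is at most the old count at `u`,
while the list has doubled: the proportion is halved. -/
theorem Focused.split {w : List Op} {u τ : List Bool} (hw : Focused w u) (hτ : u <+: τ) (b : Bool) :
    Focused (w ++ [(τ ++ [b], τ ++ [!b])]) (τ ++ [b]) ∧
    (∀ y ∈ ev (w ++ [(τ ++ [b], τ ++ [!b])]), u <+: y → τ ++ [b] <+: y ∨ τ ++ [!b] <+: y) ∧
    hi (w ++ [(τ ++ [b], τ ++ [!b])]) (τ ++ [b]) ≤ hi w u := by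
  have hu : ∀ c, u <+: τ ++ [c] := fun c => hτ.trans (List.prefix_append τ [c])
  have hne : ∀ c, ¬ τ ++ [c] <+: u := fun c h => by
    have h₁ := h.length_le
    have h₂ := hτ.length_le
    simp at h₁; omega
  have hcu : ∀ c y, Comp y (τ ++ [c]) → Comp y u := fun c y h => by
    rcases h with h | h
    · exact comp_of_prefix h (hu c)
    · exact Or.inr ((hu c).trans h)
  have hrep : ∀ c, ∀ y ∈ ev w, Comp y u → rep (τ ++ [c]) y = τ ++ [c] := fun c y hy h => by
    rw [hw y hy h, rep, if_pos (hu c)]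
  have hnot : ∀ c, ∀ y ∈ ev w, ¬ Comp y u → rep (τ ++ [c]) y = y := fun c y hy h => by
    rw [rep, if_neg fun h' => h (hcu c y (Or.inl h'))]
  refine ⟨fun y hy hc => ?_, fun y hy hc => ?_, ?_⟩
  · rw [ev_append_singleton, step, List.mem_append, List.mem_map, List.mem_map] at hy
    rcases hy with ⟨y, hy', rfl⟩ | ⟨y, hy', rfl⟩
    · by_cases h : Comp y u
      · exact hrep b y hy' h
      · rw [hnot b y hy' h] at hc
        exact (h (hcu b y hc)).elim
    · by_cases h : Comp y u
      · rw [hrep (!b) y hy' h] at hc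
        exact (not_comp_siblings τ b hc.symm).elim
      · rw [hnot (!b) y hy' h] at hc
        exact (h (hcu b y hc)).elim
  · rw [ev_append_singleton, step, List.mem_append, List.mem_map, List.mem_map] at hy
    rcases hy with ⟨y, hy', rfl⟩ | ⟨y, hy', rfl⟩
    all_goals
      by_cases h : Comp y u
      · rw [hrep _ y hy' h]; simp
      · rw [hnot _ y hy' h] at hc
        exact (h (Or.inr hc)).elim
  · rw [hi, countP_ev_append_singleton]
    have e₁ : (ev w).countP ((fun y => decide (Comp y (τ ++ [b]))) ∘ rep (τ ++ [b])) ≤ hi w u :=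
      List.countP_mono_left fun y _ hy => by
        simp only [Function.comp, decide_eq_true_eq] at hy ⊢
        exact hcu b y (comp_of_comp_rep hy)
    have e₂ : (ev w).countP ((fun y => decide (Comp y (τ ++ [b]))) ∘ rep (τ ++ [!b])) = 0 := by
      rw [List.countP_eq_zero]
      intro y hy
      simp only [Function.comp, decide_eq_true_eq]
      intro hc
      by_cases h : Comp y u
      · rw [hrep _ y hy h] at hc
        exact not_comp_siblings τ b hc.symm
      · rw [hnot _ y hy h] at hc
        exact h (hcu b y hc)
    exact (add_le_add e₁ e₂.le).trans (by simp)

/-- Operations above `v` only create strings above `v`. -/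
theorem covered_above {w : List Op} {u v : List Bool} {P : List Bool → Prop}
    (hP : ∀ y, v <+: y → P y) (h : ∀ y ∈ ev w, u <+: y → P y) (t : List Op) :
    ∀ y ∈ ev (w ++ above v t), u <+: y → P y := by
  induction t using List.reverseRecOn with
  | nil => simpa [above] using h
  | append_singleton t o ih =>
    intro y hy hc
    simp only [above, List.map_append, List.map_cons, List.map_nil] at hy
    rw [← List.append_assoc, ev_append_singleton, step, List.mem_append, List.mem_map,
      List.mem_map] at hy
    rcases hy with ⟨y', hy', rfl⟩ | ⟨y', hy', rfl⟩
    · rcases rep_eq_or (v ++ o.1) y' with e | e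
      · rw [e] at hc ⊢; exact ih y' hy' hc
      · rw [e]; exact hP _ (List.prefix_append _ _)
    · rcases rep_eq_or (v ++ o.2) y' with e | e
      · rw [e] at hc ⊢; exact ih y' hy' hc
      · rw [e]; exact hP _ (List.prefix_append _ _)

theorem length_above (u : List Bool) (t : List Op) : (above u t).length = t.length := by
  simp [above]

theorem above_append (u : List Bool) (s t : List Op) :
    above u (s ++ t) = above u s ++ above u t := by
  simp [above]

theorem above_above (u a : List Bool) (t : List Op) :
    above (u ++ a) t = above u (above a t) := by
  simp [above]

/-! ### Tables of natural numbers as names of measures with dyadic values. -/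

/-- The numerators of a measure with dyadic values, in units of `4 ^ (-(|σ| + 1))`: the value
`L σ`, cut down if necessary, is the numerator at `σ0`. The list `p` has already been passed, with
value `a` there. -/
def massAux (L : List Bool → ℕ) : List Bool → ℕ → List Bool → ℕ
  | _, a, [] => a
  | p, a, b :: σ =>
    massAux L (p ++ [b]) (if b then 4 * a - min (L p) (4 * a) else min (L p) (4 * a)) σ

/-- The numerator at `σ` of the measure given by `L`. -/
def mass (L : List Bool → ℕ) (σ : List Bool) : ℕ :=
  massAux L [] 4 σ

theorem massAux_append (L : List Bool → ℕ) (p : List Bool) (a : ℕ) (σ τ : List Bool) :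
    massAux L p a (σ ++ τ) = massAux L (p ++ σ) (massAux L p a σ) τ := by
  induction σ generalizing p a with
  | nil => simp [massAux]
  | cons b σ ih => simp [massAux, ih]

theorem mass_nil (L : List Bool → ℕ) : mass L [] = 4 := rfl

theorem mass_append_singleton (L : List Bool → ℕ) (σ : List Bool) (b : Bool) :
    mass L (σ ++ [b]) =
      if b then 4 * mass L σ - min (L σ) (4 * mass L σ) else min (L σ) (4 * mass L σ) := by
  rw [mass, massAux_append]; simp [massAux, mass]

theorem mass_children (L : List Bool → ℕ) (σ : List Bool) :
    mass L (σ ++ [false]) + mass L (σ ++ [true]) = 4 * mass L σ := by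
  simp only [mass_append_singleton]; simp

theorem mass_le (L : List Bool → ℕ) (σ : List Bool) : mass L σ ≤ 4 ^ (σ.length + 1) := by
  induction σ using List.reverseRecOn with
  | nil => simp [mass_nil]
  | append_singleton σ b ih =>
    have h := mass_children L σ
    rw [List.length_append, List.length_singleton, pow_succ]
    cases b <;> omega

/-- Proper initial segments have smaller codes, so the value of a measure at `σ` depends only on
table entries below the code of `σ`. -/
theorem encode_le_of_prefix {σ τ : List Bool} (h : σ <+: τ) :
    Encodable.encode σ ≤ Encodable.encode τ := by
  induction σ generalizing τ with
  | nil => simp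
  | cons a σ ih =>
    obtain ⟨ρ, rfl⟩ := h
    simp only [List.cons_append, Encodable.encode_list_cons]
    rcases (ih (List.prefix_append σ ρ)).eq_or_lt with e | e
    · rw [e]
    · exact Nat.succ_le_succ (Nat.pair_lt_pair_right _ e).le

theorem encode_lt_of_prefix {σ τ : List Bool} (h : σ <+: τ) (hne : σ ≠ τ) :
    Encodable.encode σ < Encodable.encode τ :=
  lt_of_le_of_ne (encode_le_of_prefix h) fun e => hne (Encodable.encode_injective e)

theorem length_le_encode (σ : List Bool) : σ.length ≤ Encodable.encode σ := by
  induction σ with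
  | nil => simp
  | cons a σ ih =>
    simp only [List.length_cons, Encodable.encode_list_cons]
    exact Nat.succ_le_succ (ih.trans (Nat.right_le_pair _ _))

theorem mass_congr {L L' : List Bool → ℕ} {σ : List Bool}
    (h : ∀ τ, Encodable.encode τ < Encodable.encode σ → L τ = L' τ) : mass L σ = mass L' σ := by
  induction σ using List.reverseRecOn with
  | nil => rfl
  | append_singleton σ b ih =>
    have hlt : Encodable.encode σ < Encodable.encode (σ ++ [b]) :=
      encode_lt_of_prefix (List.prefix_append _ _) (by simp)
    rw [mass_append_singleton, mass_append_singleton, ih fun τ hτ => h τ (hτ.trans hlt), h σ hlt]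

/-- The function on strings tabulated by the list `z`. -/
def table (z : List ℕ) (σ : List Bool) : ℕ :=
  z.getD (Encodable.encode σ) 0

/-- The numerators of the measure tabulated by `z`. They are reliable for strings whose code is
less than the length of `z`. -/
def massOf (z : List ℕ) (σ : List Bool) : ℕ :=
  mass (table z) σ

theorem table_of_prefix {z z' : List ℕ} (h : z <+: z') {σ : List Bool}
    (hσ : Encodable.encode σ < z.length) : table z σ = table z' σ := by
  obtain ⟨r, rfl⟩ := h
  simp [table, List.getD, List.getElem?_append_left hσ]

theorem massOf_of_prefix {z z' : List ℕ} (h : z <+: z') {σ : List Bool}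
    (hσ : Encodable.encode σ < z.length) : massOf z σ = massOf z' σ :=
  mass_congr fun _ hτ => table_of_prefix h (hτ.trans hσ)

/-- The finite set of tables of length `s` that has to be considered. -/
def tables (s : ℕ) : List (List ℕ) :=
  -- The entry at the code n of a string τ matters only up to four times the numerator at τ, that is
  -- up to 4^(|τ|+2), and |τ| ≤ n.
  s.rec [[]] fun n T => T.flatMap fun z => (List.range (4 ^ (n + 2) + 1)).map fun j => z ++ [j]

theorem mem_tables_succ {s : ℕ} {z : List ℕ} :
    z ∈ tables (s + 1) ↔ ∃ z' ∈ tables s, ∃ j ≤ 4 ^ (s + 2), z = z' ++ [j] := by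
  simp only [tables, List.mem_flatMap, List.mem_map, List.mem_range, Nat.lt_succ_iff]
  refine exists_congr fun z' => and_congr_right fun _ => exists_congr fun j => ?_
  simp [eq_comm]

theorem length_of_mem_tables {s : ℕ} {z : List ℕ} (h : z ∈ tables s) : z.length = s := by
  induction s generalizing z with
  | zero => simp [tables] at h; simp [h]
  | succ s ih =>
    obtain ⟨z', hz', j, -, rfl⟩ := mem_tables_succ.1 h
    simp [ih hz']

theorem take_mem_tables {s s' : ℕ} (hs : s ≤ s') {z : List ℕ} (h : z ∈ tables s') :
    z.take s ∈ tables s := by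
  induction s', hs using Nat.le_induction generalizing z with
  | base => rwa [List.take_of_length_le (length_of_mem_tables h).le]
  | succ n hn ih =>
    obtain ⟨z', hz', j, -, rfl⟩ := mem_tables_succ.1 h
    rw [List.take_append_of_le_length (by rw [length_of_mem_tables hz']; exact hn)]
    exact ih hz'

theorem map_range_mem_tables {f : ℕ → ℕ} (hf : ∀ i, f i ≤ 4 ^ (i + 2)) (s : ℕ) :
    (List.range s).map f ∈ tables s := by
  induction s with
  | zero => simp [tables]
  | succ s ih =>
    rw [List.range_succ, List.map_append]
    exact mem_tables_succ.2 ⟨_, ih, _, hf s, rfl⟩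

/-! ### Consistency of tables with lists, and the existence of consistent tables. -/

/-- The table `z` is consistent with the list `ev w`: its measure is, up to a small error, at least
half of the weight of the strings that have entered a cylinder and at most half of the weight of
those that may still enter it. -/
def Cons (z : List ℕ) (w : List Op) : Prop :=
  ∀ σ : List Bool, Encodable.encode σ < z.length →
    lo w σ * 4 ^ (σ.length + 1) ≤ 2 * massOf z σ * 2 ^ w.length ∧
    2 * massOf z σ * 2 ^ w.length ≤
      hi w σ * 4 ^ (σ.length + 1) + 8 * 2 ^ σ.length * 2 ^ w.length

theorem Cons.of_prefix_left {z z' : List ℕ} (h : z <+: z') {w : List Op} (hc : Cons z' w) :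
    Cons z w := fun σ hσ => by
  rw [massOf_of_prefix h hσ]
  exact hc σ (hσ.trans_le h.length_le)

theorem Cons.of_append {z : List ℕ} {w t : List Op} (hc : Cons z (w ++ t)) : Cons z w :=
  fun σ hσ => by
  obtain ⟨h₁, h₂⟩ := hc σ hσ
  rw [List.length_append, pow_add] at h₁ h₂
  have hp : 0 < 2 ^ t.length := by positivity
  constructor
  · refine Nat.le_of_mul_le_mul_left ?_ hp
    calc 2 ^ t.length * (lo w σ * 4 ^ (σ.length + 1))
        = (2 ^ t.length * lo w σ) * 4 ^ (σ.length + 1) := by ring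
      _ ≤ lo (w ++ t) σ * 4 ^ (σ.length + 1) := Nat.mul_le_mul_right _ (le_lo_append w t σ)
      _ ≤ _ := h₁
      _ = _ := by ring
  · refine Nat.le_of_mul_le_mul_left ?_ hp
    calc 2 ^ t.length * (2 * massOf z σ * 2 ^ w.length)
        = 2 * massOf z σ * (2 ^ w.length * 2 ^ t.length) := by ring
      _ ≤ _ := h₂
      _ ≤ (2 ^ t.length * hi w σ) * 4 ^ (σ.length + 1) +
          8 * 2 ^ σ.length * (2 ^ w.length * 2 ^ t.length) :=
        Nat.add_le_add_right (Nat.mul_le_mul_right _ (hi_append_le w t σ)) _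
      _ = _ := by ring

/-- The string `σ` is an initial segment of `y000…`. -/
def OnZeros (σ y : List Bool) : Prop :=
  σ <+: y ++ List.replicate σ.length false

instance (σ y : List Bool) : Decidable (OnZeros σ y) :=
  inferInstanceAs (Decidable (_ <+: _))

/-- The number of `y` in `ev w` such that `y000…` extends `σ`. -/
def padded (w : List Op) (σ : List Bool) : ℕ :=
  (ev w).countP fun y => OnZeros σ y

theorem onZeros_iff {σ y : List Bool} {n : ℕ} (h : σ.length ≤ n) :
    OnZeros σ y ↔ σ <+: y ++ List.replicate n false := by
  obtain ⟨k, rfl⟩ := Nat.exists_eq_add_of_le h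
  rw [OnZeros, List.replicate_add, ← List.append_assoc]
  refine ⟨fun h' => h'.trans (List.prefix_append _ _), fun h' => ?_⟩
  exact List.prefix_of_prefix_length_le h' (List.prefix_append _ _) (by simp)

/-- Padding by zeros turns each string into a point of Cantor space, so the count becomes additive,
which `lo` and `hi` are not; it lies between these two. -/
theorem padded_children (w : List Op) (σ : List Bool) :
    padded w (σ ++ [false]) + padded w (σ ++ [true]) = padded w σ := by
  have key : ∀ y, (OnZeros σ y ↔ OnZeros (σ ++ [false]) y ∨ OnZeros (σ ++ [true]) y) ∧
      ¬ (OnZeros (σ ++ [false]) y ∧ OnZeros (σ ++ [true]) y) := by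
    intro y
    rw [onZeros_iff (σ := σ) (n := σ.length + 1) (by simp),
      onZeros_iff (σ := σ ++ [false]) (n := σ.length + 1) (by simp),
      onZeros_iff (σ := σ ++ [true]) (n := σ.length + 1) (by simp)]
    set Y := y ++ List.replicate (σ.length + 1) false with hY
    have hl : σ.length < Y.length := by simp [hY]; omega
    refine ⟨⟨fun ⟨r, hr⟩ => ?_, fun h => ?_⟩, fun ⟨h₁, h₂⟩ => ?_⟩
    · cases r with
      | nil => rw [← hr] at hl; simp at hl
      | cons c r =>
        cases c
        · exact Or.inl ⟨r, by simpa using hr⟩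
        · exact Or.inr ⟨r, by simpa using hr⟩
    · exact h.elim (fun h => (List.prefix_append _ _).trans h)
        fun h => (List.prefix_append _ _).trans h
    · have := (List.prefix_of_prefix_length_le h₁ h₂ (by simp)).eq_of_length (by simp)
      simp at this
  unfold padded
  induction ev w with
  | nil => rfl
  | cons y l ih =>
    obtain ⟨h₁, h₂⟩ := key y
    simp only [List.countP_cons, decide_eq_true_eq]
    by_cases ha : OnZeros (σ ++ [false]) y <;> by_cases hb : OnZeros (σ ++ [true]) y <;>
      simp only [ha, hb, h₁] at h₂ ⊢ <;> simp at h₂ ⊢ <;> omega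

theorem padded_nil (w : List Op) : padded w [] = 2 ^ w.length := by
  rw [← length_ev, padded, List.countP_eq_length]; simp [OnZeros]

theorem lo_le_padded (w : List Op) (σ : List Bool) : lo w σ ≤ padded w σ :=
  List.countP_mono_left fun y _ hy => by
    simp only [decide_eq_true_eq] at hy ⊢
    exact hy.trans (List.prefix_append _ _)

theorem padded_le_hi (w : List Op) (σ : List Bool) : padded w σ ≤ hi w σ :=
  List.countP_mono_left fun y _ hy => by
    simp only [decide_eq_true_eq] at hy ⊢
    exact comp_of_prefix (List.prefix_append _ _) hy

/-- A measure with dyadic values close to the average of the measure given by `padded w` and the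
uniform measure; the argument is the reverse of the string. -/
def rounding (w : List Op) : List Bool → ℕ
  | [] => 4
  | b :: r =>
    let c := (4 ^ (r.length + 2) * padded w (r.reverse ++ [false]) +
      (2 * (2 * 2 ^ w.length * rounding w r) - 2 * (4 ^ (r.length + 1) * padded w r.reverse))) /
      (2 * 2 ^ w.length)
    if b then 4 * rounding w r - c else c

/-- Here `a` is the numerator at a node, `P` is 2 to its length and `V0 + V1` its padded count. The
excess `2 * N * a - A * (V0 + V1)` is the share of the uniform part, ideally `4 * N * P`. Passing to
a child doubles it up to an error of `2 * N` from the integer division. The margins `2 * N` in both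
bounds absorb exactly this error, so the bounds reproduce themselves. -/
theorem rounding_step {N a A V0 V1 P c : ℕ} (hN : 0 < N)
    (hlow : A * (V0 + V1) + 2 * N * P + 2 * N ≤ 2 * N * a)
    (hup : 2 * N * a + 2 * N ≤ A * (V0 + V1) + 6 * N * P)
    (hc : c = (4 * A * V0 + (2 * (2 * N * a) - 2 * (A * (V0 + V1)))) / (2 * N)) :
    (4 * A * V0 + 2 * N * (2 * P) + 2 * N ≤ 2 * N * c ∧
      2 * N * c + 2 * N ≤ 4 * A * V0 + 6 * N * (2 * P)) ∧
    (4 * A * V1 + 2 * N * (2 * P) + 2 * N ≤ 2 * N * (4 * a - c) ∧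
      2 * N * (4 * a - c) + 2 * N ≤ 4 * A * V1 + 6 * N * (2 * P)) ∧ c ≤ 4 * a := by
  have h₁ := Nat.div_mul_le_self (4 * A * V0 + (2 * (2 * N * a) - 2 * (A * (V0 + V1)))) (2 * N)
  have h₂ := Nat.lt_div_mul_add (a := 4 * A * V0 + (2 * (2 * N * a) - 2 * (A * (V0 + V1))))
    (show 0 < 2 * N by omega)
  rw [← hc] at h₁ h₂
  rw [mul_comm c] at h₁ h₂
  have e₁ : A * (V0 + V1) = A * V0 + A * V1 := by ring
  have e₂ : ∀ x, 4 * A * x = 4 * (A * x) := fun x => by ring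
  have e₃ : 2 * N * P = 2 * (N * P) := by ring
  have e₄ : 6 * N * P = 6 * (N * P) := by ring
  have e₅ : 2 * N * (2 * P) = 4 * (N * P) := by ring
  have e₆ : 6 * N * (2 * P) = 12 * (N * P) := by ring
  have e₇ : 2 * N * (4 * a - c) = 4 * (2 * N * a) - 2 * N * c := by
    rw [Nat.mul_sub]; ring_nf
  rw [e₁] at hlow hup h₁ h₂
  rw [e₂] at h₁ h₂
  rw [e₃] at hlow
  rw [e₄] at hup
  rw [e₅, e₆, e₇, e₂, e₂]
  have h₃ : 2 * N * c ≤ 2 * N * (4 * a) := by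
    have : 2 * N * (4 * a) = 4 * (2 * N * a) := by ring
    omega
  refine ⟨⟨?_, ?_⟩, ⟨?_, ?_⟩, Nat.le_of_mul_le_mul_left h₃ (by omega)⟩ <;> omega

theorem rounding_bounds (w : List Op) (r : List Bool) :
    4 ^ (r.length + 1) * padded w r.reverse + 2 * 2 ^ w.length * 2 ^ r.length + 2 * 2 ^ w.length ≤
        2 * 2 ^ w.length * rounding w r ∧
      2 * 2 ^ w.length * rounding w r + 2 * 2 ^ w.length ≤
        4 ^ (r.length + 1) * padded w r.reverse + 6 * 2 ^ w.length * 2 ^ r.length := by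
  induction r with
  | nil =>
    simp only [List.length_nil, zero_add, pow_one, List.reverse_nil, padded_nil, pow_zero,
      rounding]
    constructor <;> omega
  | cons b r ih =>
    obtain ⟨h₁, h₂⟩ := ih
    rw [← padded_children] at h₁ h₂
    obtain ⟨k₀, k₁, -⟩ := rounding_step (by positivity) h₁ h₂ rfl
    have e : 4 ^ (r.length + 2) = 4 * 4 ^ (r.length + 1) := by ring
    rw [padded_children] at k₀ k₁
    rw [List.length_cons, e, pow_succ' 2, List.reverse_cons, rounding, e]
    cases b
    · exact k₀
    · exact k₁

theorem rounding_false_le (w : List Op) (r : List Bool) :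
    rounding w (false :: r) ≤ 4 * rounding w r := by
  obtain ⟨h₁, h₂⟩ := rounding_bounds w r
  rw [← padded_children] at h₁ h₂
  have k := (rounding_step (by positivity) h₁ h₂ rfl).2.2
  have e : 4 ^ (r.length + 2) = 4 * 4 ^ (r.length + 1) := by ring
  rw [padded_children] at k
  rw [rounding, e]
  exact k

theorem exists_cons (w : List Op) (s : ℕ) : ∃ z ∈ tables s, Cons z w := by
  -- A table stores at `σ` the numerator of its child `σ0`; `rounding` takes reversed strings.
  set L : List Bool → ℕ := fun σ => rounding w (false :: σ.reverse) with hL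
  have hmass : ∀ σ, mass L σ = rounding w σ.reverse := by
    intro σ
    induction σ using List.reverseRecOn with
    | nil => rfl
    | append_singleton σ b ih =>
      rw [mass_append_singleton, ih, hL, min_eq_left (rounding_false_le w σ.reverse)]
      cases b <;> simp [rounding]
  have hLle : ∀ σ, L σ ≤ 4 ^ (σ.length + 2) := fun σ => by
    have h₁ := rounding_false_le w σ.reverse
    have h₂ := mass_le L σ
    rw [hmass] at h₂
    rw [pow_succ]
    simp only [hL]; omega
  set f : ℕ → ℕ := fun i => ((Encodable.decode₂ (List Bool) i).map L).getD 0 with hf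
  have hfle : ∀ i, f i ≤ 4 ^ (i + 2) := fun i => by
    simp only [hf]
    cases h : Encodable.decode₂ (List Bool) i with
    | none => simp
    | some σ =>
      have e : Encodable.encode σ = i := Encodable.mem_decode₂.1 h
      refine (hLle σ).trans (Nat.pow_le_pow_right (by norm_num) ?_)
      rw [← e]; exact Nat.add_le_add_right (length_le_encode σ) 2
  refine ⟨_, map_range_mem_tables hfle s, fun σ hσ => ?_⟩
  simp only [List.length_map, List.length_range] at hσ
  have hm : massOf ((List.range s).map f) σ = rounding w σ.reverse := by
    rw [← hmass]
    refine mass_congr fun τ hτ => ?_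
    simp [table, List.getD, hτ.trans hσ, hf]
  obtain ⟨h₁, h₂⟩ := rounding_bounds w σ.reverse
  rw [List.length_reverse, List.reverse_reverse] at h₁ h₂
  rw [hm]
  have e₁ : 2 * 2 ^ w.length * rounding w σ.reverse = 2 * rounding w σ.reverse * 2 ^ w.length := by
    ring
  have e₂ : 6 * 2 ^ w.length * 2 ^ σ.length ≤ 8 * 2 ^ σ.length * 2 ^ w.length := by
    rw [mul_right_comm 6]; gcongr; norm_num
  rw [e₁, mul_comm (4 ^ _)] at h₁ h₂
  constructor
  · exact (Nat.mul_le_mul_right _ (lo_le_padded w σ)).trans (by omega)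
  · have := Nat.mul_le_mul_right (4 ^ (σ.length + 1)) (padded_le_hi w σ)
    omega

/-! ### Covering by tests, and the forcing relation. -/

/-- The strings whose code is less than `s`. -/
def strings (s : ℕ) : List (List Bool) :=
  (List.range s).filterMap (Encodable.decode₂ (List Bool))

theorem mem_strings {s : ℕ} {σ : List Bool} : σ ∈ strings s ↔ Encodable.encode σ < s := by
  simp only [strings, List.mem_filterMap, List.mem_range]
  constructor
  · rintro ⟨i, hi, h⟩
    rwa [Encodable.mem_decode₂.1 h]
  · exact fun h => ⟨_, h, Encodable.decode₂_encode σ⟩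

theorem nodup_strings (s : ℕ) : (strings s).Nodup :=
  List.nodup_range.filterMap fun _ _ _ h₁ h₂ =>
    (Encodable.mem_decode₂.1 h₁).symm.trans (Encodable.mem_decode₂.1 h₂)

open Classical in
/-- The sum of the measures of the cylinders enumerated by `E` at stage `z`, in units of
`4 ^ (-(|z| + 1))`. -/
noncomputable def weight (E : List ℕ → List Bool → Prop) (z : List ℕ) : ℕ :=
  ((strings z.length).map fun σ =>
    if E z σ then massOf z σ * 4 ^ (z.length - σ.length) else 0).sum

/-- The string `y` is covered by a cylinder that is enumerated by `E` at a stage before `z` at which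
the sum of the measures of the enumerated cylinders is at most `2 ^ (-n)`. -/
def Covered (E : List ℕ → List Bool → Prop) (n : ℕ) (z : List ℕ) (y : List Bool) : Prop :=
  ∃ i ≤ z.length, weight E (z.take i) * 2 ^ n ≤ 4 ^ (i + 1) ∧
    ∃ σ ∈ strings i, E (z.take i) σ ∧ σ <+: y

/-- A relation between tables and strings that is preserved when the table is extended. -/
def Increasing (E : List ℕ → List Bool → Prop) : Prop :=
  ∀ ⦃z z' : List ℕ⦄, z <+: z' → ∀ σ, E z σ → E z' σ

theorem Covered.increasing (E : List ℕ → List Bool → Prop) (n : ℕ) :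
    Increasing (Covered E n) := by
  rintro z _ ⟨r, rfl⟩ y ⟨i, hi, h₁, h₂⟩
  refine ⟨i, hi.trans (by simp), ?_⟩
  rw [List.take_append_of_le_length hi]
  exact ⟨h₁, h₂⟩

/-- A union bound for counting in lists. -/
theorem countP_exists_le_sum {α β : Type*} (l : List α) (m : List β) (P : β → α → Prop)
    [DecidablePred fun a => ∃ b ∈ m, P b a] [∀ b, DecidablePred (P b)] :
    l.countP (fun a => ∃ b ∈ m, P b a) ≤ (m.map fun b => l.countP fun a => P b a).sum := by
  classical
  induction l with
  | nil => simp
  | cons a l ih =>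
    simp only [List.countP_cons, decide_eq_true_eq, List.sum_map_add]
    refine add_le_add ih ?_
    split_ifs with h
    · obtain ⟨b, hb, hP⟩ := h
      have := List.single_le_sum (l := m.map fun b => if P b a then 1 else 0) (by simp)
        1 (List.mem_map.2 ⟨b, hb, by simp [hP]⟩)
      exact this
    · simp

theorem countP_le_add {α : Type*} {p q r : α → Bool} (l : List α)
    (h : ∀ a ∈ l, p a → q a ∨ r a) : l.countP p ≤ l.countP q + l.countP r := by
  induction l with
  | nil => simp
  | cons a l ih =>
    have ih' := ih fun b hb => h b (by simp [hb])
    have ha := h a (by simp)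
    simp only [List.countP_cons]
    by_cases hp : p a
    · rcases ha hp with hq | hr
      · simp only [hp, hq, if_true]; omega
      · simp only [hp, hr, if_true]; omega
    · simp only [hp]; simp; omega

/-- This is where the lower half of `Cons` is used: the weight that has entered a cylinder is at
most twice its measure, whence the factor 2. -/
theorem sum_lo_le {z : List ℕ} {w : List Op} (hc : Cons z w) (E : List ℕ → List Bool → Prop)
    {n : ℕ} (h : weight E z * 2 ^ n ≤ 4 ^ (z.length + 1)) [DecidablePred (E z)] :
    2 ^ n * (((strings z.length).filter fun σ => E z σ).map (lo w)).sum ≤ 2 * 2 ^ w.length := by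
  have key : 4 ^ (z.length + 1) *
      (((strings z.length).filter fun σ => E z σ).map (lo w)).sum ≤
      2 * 2 ^ w.length * weight E z := by
    have : ∀ l : List (List Bool), (∀ σ ∈ l, Encodable.encode σ < z.length) →
        4 ^ (z.length + 1) * ((l.filter fun σ => E z σ).map (lo w)).sum ≤
        2 * 2 ^ w.length * (l.map fun σ =>
          if E z σ then massOf z σ * 4 ^ (z.length - σ.length) else 0).sum := by
      intro l hl
      induction l with
      | nil => simp
      | cons σ l ih =>
        have ih' := ih fun τ hτ => hl τ (by simp [hτ])
        by_cases hσ : E z σ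
        · have hlt := hl σ (by simp)
          have h₁ := (hc σ hlt).1
          have hlen : σ.length ≤ z.length := (length_le_encode σ).trans hlt.le
          simp only [List.filter_cons, hσ, decide_true, if_true, List.map_cons, List.sum_cons]
          rw [mul_add, mul_add]
          refine add_le_add ?_ ih'
          calc 4 ^ (z.length + 1) * lo w σ
              = (lo w σ * 4 ^ (σ.length + 1)) * 4 ^ (z.length - σ.length) := by
                rw [mul_assoc, ← pow_add, mul_comm]; congr 2; omega
            _ ≤ _ := Nat.mul_le_mul_right _ h₁
            _ = _ := by ring
        · simpa [List.filter_cons, hσ] using ih'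
    have := this (strings z.length) fun σ hσ => mem_strings.1 hσ
    rw [weight]
    convert this
  refine Nat.le_of_mul_le_mul_left (c := 4 ^ (z.length + 1)) ?_
    (pow_pos (show 0 < 4 by norm_num) (z.length + 1))
  calc _ = 2 ^ n * (4 ^ (z.length + 1) *
        (((strings z.length).filter fun σ => E z σ).map (lo w)).sum) := by ring
    _ ≤ 2 ^ n * (2 * 2 ^ w.length * weight E z) := Nat.mul_le_mul_left _ key
    _ = 2 * 2 ^ w.length * (weight E z * 2 ^ n) := by ring
    _ ≤ 2 * 2 ^ w.length * 4 ^ (z.length + 1) := Nat.mul_le_mul_left _ h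
    _ = _ := by ring

open Classical in
theorem countP_covered_le {z : List ℕ} {w : List Op} (hc : Cons z w)
    {E : List ℕ → List Bool → Prop} (hE : Increasing E) (n : ℕ) :
    2 ^ n * (ev w).countP (fun y => Covered E n z y) ≤ 2 * 2 ^ w.length := by
  set Q : ℕ → Prop := fun i => weight E (z.take i) * 2 ^ n ≤ 4 ^ (i + 1) with hQ
  by_cases h : ∃ i ≤ z.length, Q i
  · obtain ⟨i₀, hi₀, hQ₀⟩ := h
    -- At the last stage at which the enumerated cylinders are still small, all cylinders that count
    -- for `Covered` are already present, so a single application of the bound suffices.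
    set k := Nat.findGreatest Q z.length with hk
    have hkQ : Q k := Nat.findGreatest_spec hi₀ hQ₀
    have hkl : k ≤ z.length := Nat.findGreatest_le _
    have hlen : (z.take k).length = k := by simp [hkl]
    refine le_trans ?_ (sum_lo_le (z := z.take k) (hc.of_prefix_left (List.take_prefix _ _)) E
      (n := n) (by rw [hlen]; exact hkQ))
    refine Nat.mul_le_mul_left _ (le_trans (List.countP_mono_left (fun y _ hy => ?_))
      (countP_exists_le_sum (ev w) _ fun σ y => σ <+: y))
    simp only [decide_eq_true_eq] at hy ⊢
    obtain ⟨i, hi, h₁, σ, hσ, h₂, h₃⟩ := hy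
    have hik : i ≤ k := Nat.le_findGreatest hi h₁
    refine ⟨σ, ?_, h₃⟩
    rw [List.mem_filter, hlen]
    refine ⟨mem_strings.2 ((mem_strings.1 hσ).trans_le hik), ?_⟩
    simpa using hE (List.take_prefix_take_left hik) σ h₂
  · have : (ev w).countP (fun y => Covered E n z y) = 0 := by
      rw [List.countP_eq_zero]
      intro y _ hy
      simp only [decide_eq_true_eq] at hy
      obtain ⟨i, hi, h₁, -⟩ := hy
      exact h ⟨i, hi, h₁⟩
    simp [this]

open Classical in
/-- The number of members of `ev w` that extend `u` and are not bad at `z`. -/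
noncomputable def goodCount (Bd : List ℕ → List Bool → Prop) (z : List ℕ) (w : List Op)
    (u : List Bool) : ℕ :=
  (ev w).countP fun y => u <+: y ∧ ¬ Bd z y

/-- There are at least the proportion `1 / N` of good strings above `u` with respect to some
consistent table, and this remains true after any further operations above `u`. -/
def Forces (Bd : List ℕ → List Bool → Prop) (w : List Op) (u : List Bool) (N : ℕ) : Prop :=
  ∀ (t : List Op) (s : ℕ), ∃ z ∈ tables s, Cons z (w ++ above u t) ∧
    2 ^ (w ++ above u t).length ≤ N * goodCount Bd z (w ++ above u t) u

theorem goodCount_anti {Bd : List ℕ → List Bool → Prop} (hB : Increasing Bd) {z z' : List ℕ}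
    (h : z <+: z') (w : List Op) (u : List Bool) : goodCount Bd z' w u ≤ goodCount Bd z w u :=
  List.countP_mono_left fun y _ hy => by
    simp only [decide_eq_true_eq] at hy ⊢
    exact ⟨hy.1, fun hz => hy.2 (hB h y hz)⟩

theorem forces_initial : Forces (fun _ _ => False) [] [] 1 := by
  intro t s
  obtain ⟨z, hz, hc⟩ := exists_cons ([] ++ above [] t) s
  refine ⟨z, hz, hc, ?_⟩
  rw [← length_ev, one_mul, goodCount, List.countP_eq_length.2 (by simp)]

/-- The new test covers at most a proportion 2·2⁻ⁿ ≤ 1/(2N) of the list, leaving 1/N - 1/(2N) for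
the good strings. -/
theorem Forces.or_covered {Bd : List ℕ → List Bool → Prop} {w : List Op} {u : List Bool} {N : ℕ}
    (h : Forces Bd w u N) {E : List ℕ → List Bool → Prop} (hE : Increasing E) {n : ℕ}
    (hn : 4 * N ≤ 2 ^ n) : Forces (fun z y => Bd z y ∨ Covered E n z y) w u (2 * N) := by
  classical
  intro t s
  obtain ⟨z, hz, hc, hg⟩ := h t s
  refine ⟨z, hz, hc, ?_⟩
  set W := w ++ above u t
  have h₁ := countP_covered_le hc hE n
  have h₂ : goodCount Bd z W u ≤ goodCount (fun z y => Bd z y ∨ Covered E n z y) z W u +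
      (ev W).countP (fun y => Covered E n z y) := by
    refine countP_le_add _ fun y _ hy => ?_
    simp only [decide_eq_true_eq] at hy ⊢
    by_cases hc : Covered E n z y
    · exact Or.inr hc
    · exact Or.inl ⟨hy.1, not_or.2 ⟨hy.2, hc⟩⟩
  have h₃ : 2 * N * (ev W).countP (fun y => Covered E n z y) ≤ 2 ^ W.length := by
    have := Nat.mul_le_mul_right ((ev W).countP fun y => Covered E n z y) hn
    have e : 4 * N * (ev W).countP (fun y => Covered E n z y) =
      2 * (2 * N * (ev W).countP (fun y => Covered E n z y)) := by ring
    omega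
  have h₄ := Nat.mul_le_mul_left (2 * N) h₂
  rw [mul_add] at h₄
  have e : 2 * N * goodCount Bd z W u = 2 * (N * goodCount Bd z W u) := by ring
  omega

/-- If both halves of a split can be extended and neither of the two ways to go on with the first
half works, then the first half is ruled out and the second one is not. -/
theorem Forces.split {Bd : List ℕ → List Bool → Prop} (hB : Increasing Bd) {w : List Op}
    {u : List Bool} {N : ℕ} (h : Forces Bd w u N) (hw : Focused w u) {τ : List Bool}
    (hτ : u <+: τ) (b : Bool)
    (hS : ¬ Forces Bd (w ++ [(τ ++ [!b], τ ++ [b])]) (τ ++ [!b]) (2 * N)) :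
    ∃ t : List Op, Forces Bd (w ++ [(τ ++ [!b], τ ++ [b])] ++ above (τ ++ [!b]) t) (τ ++ [b])
      (2 * N) := by
  classical
  set v := τ ++ [b] with hv
  set v' := τ ++ [!b] with hv'
  set w₁ := w ++ [(v', v)] with hw₁
  have hvv' : ¬ Comp v v' := not_comp_siblings τ b
  unfold Forces at hS
  push Not at hS
  obtain ⟨t, s₀, ht⟩ := hS
  refine ⟨t, fun t' s => ?_⟩
  obtain ⟨ρ, hρ⟩ := hτ
  -- The split, the witness `t` on one side and the future `t'` on the other side together form one
  -- sequence of operations above `u`, to which `h` applies.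
  set r : List Op := (ρ ++ [!b], ρ ++ [b]) :: (above (ρ ++ [!b]) t ++ above (ρ ++ [b]) t') with hr
  have hW : w₁ ++ above v' t ++ above v t' = w ++ above u r := by
    have e₁ : u ++ (ρ ++ [b]) = v := by rw [hv, ← hρ, List.append_assoc]
    have e₂ : u ++ (ρ ++ [!b]) = v' := by rw [hv', ← hρ, List.append_assoc]
    have e₃ : above u r = (v', v) :: (above v' t ++ above v t') := by
      rw [← e₁, ← e₂, above_above u, above_above u, hr, ← above_append]; rfl
    rw [e₃, hw₁]; simp only [List.append_assoc, List.nil_append, List.cons_append]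
  obtain ⟨z, hz, hc, hg⟩ := h r (max s s₀)
  rw [← hW] at hc hg
  refine ⟨z.take s, take_mem_tables (le_max_left _ _) hz,
    hc.of_prefix_left (List.take_prefix _ _), ?_⟩
  set W := w₁ ++ above v' t ++ above v t' with hWdef
  -- The witness of failure speaks of all consistent tables of length `s₀`, in particular of this
  -- restriction of `z`.
  have hlt := ht (z.take s₀) (take_mem_tables (le_max_right _ _) hz)
    ((hc.of_append).of_prefix_left (List.take_prefix _ _))
  have hsub : goodCount Bd z W u ≤ goodCount Bd z W v + goodCount Bd z W v' := by
    have hcov : ∀ y ∈ ev W, u <+: y → v <+: y ∨ v' <+: y := by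
      refine covered_above (fun y => Or.inl) ?_ t'
      refine covered_above (fun y => Or.inr) (fun y hy huy => ?_) t
      have := (hw.split ⟨ρ, hρ⟩ (!b)).2.1 y (by simpa using hy) huy
      simpa using this.symm
    refine countP_le_add _ fun y hy hg => ?_
    simp only [decide_eq_true_eq] at hg ⊢
    exact (hcov y hy hg.1).imp (fun h => ⟨h, hg.2⟩) fun h => ⟨h, hg.2⟩
  -- The later operations `t'` take place above `v` and do not change the proportion of good strings
  -- above `v'`, which therefore stays below 1/(2N).
  have hside : goodCount Bd z W v' = 2 ^ t'.length * goodCount Bd z (w₁ ++ above v' t) v' :=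
    countP_above (fun h => hvv' h.symm) _ t' fun y => ¬ Bd z y
  have h₁ : goodCount Bd z (w₁ ++ above v' t) v' ≤
      goodCount Bd (z.take s₀) (w₁ ++ above v' t) v' :=
    goodCount_anti hB (List.take_prefix _ _) _ _
  have h₂ : goodCount Bd z W v ≤ goodCount Bd (z.take s) W v :=
    goodCount_anti hB (List.take_prefix _ _) _ _
  have hlen : W.length = (w₁ ++ above v' t).length + t'.length := by
    rw [hWdef, List.length_append (as := w₁ ++ above v' t), length_above]
  have h₃ : 2 * N * goodCount Bd z W v' ≤ 2 ^ W.length := by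
    rw [hside, hlen, pow_add]
    calc _ = (2 * N * goodCount Bd z (w₁ ++ above v' t) v') * 2 ^ t'.length := by ring
      _ ≤ _ := Nat.mul_le_mul_right _ ((Nat.mul_le_mul_left _ h₁).trans hlt.le)
  have h₄ := Nat.mul_le_mul_left (2 * N) hsub
  have h₅ := Nat.mul_le_mul_left (2 * N) h₂
  rw [mul_add] at h₄
  have e : 2 * N * goodCount Bd z W u = 2 * (N * goodCount Bd z W u) := by ring
  omega

/-! ### Primitive recursiveness of the notions that enter the search. -/

section Primrec

variable {α β σ : Type*} [Primcodable α] [Primcodable β] [Primcodable σ]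

theorem primrec_nat_pow : Primrec₂ ((· ^ ·) : ℕ → ℕ → ℕ) :=
  Primrec₂.unpaired'.1 Nat.Primrec.pow

theorem primrec_countP {f : α → List β} {p : α → β → Prop} [∀ a, DecidablePred (p a)]
    (hf : Primrec f) (hp : PrimrecRel p) :
    Primrec fun a => (f a).countP fun b => p a b := by
  classical
  have h : Primrec fun a => (f a).filterMap fun b => if p a b then some b else none :=
    Primrec.listFilterMap hf (Primrec.ite hp (Primrec.option_some.comp Primrec.snd)
      (Primrec.const none))
  refine (Primrec.list_length.comp h).of_eq fun a => ?_
  induction f a with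
  | nil => rfl
  | cons b l ih =>
    by_cases hb : p a b <;> simp [hb, ih]

theorem primrec_sum {f : α → List ℕ} (hf : Primrec f) : Primrec fun a => (f a).sum := by
  have h : Primrec₂ fun (_ : α) (p : ℕ × ℕ) => p.1 + p.2 :=
    Primrec.nat_add.comp (Primrec.fst.comp Primrec.snd) (Primrec.snd.comp Primrec.snd)
  exact (Primrec.list_foldr hf (Primrec.const 0) h).of_eq fun a => by
    rw [List.sum_eq_foldr]

theorem PrimrecRel.forall_mem {f : α → List β} {p : α → β → Prop} (hf : Primrec f)
    (hp : PrimrecRel p) : PrimrecPred fun a => ∀ b ∈ f a, p a b :=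
  (PrimrecRel.forall_mem_list (R := fun b a => p a b) (hp.comp Primrec.snd Primrec.fst)).comp hf
    Primrec.id

theorem PrimrecRel.exists_mem {f : α → List β} {p : α → β → Prop} (hf : Primrec f)
    (hp : PrimrecRel p) : PrimrecPred fun a => ∃ b ∈ f a, p a b :=
  (PrimrecRel.exists_mem_list (R := fun b a => p a b) (hp.comp Primrec.snd Primrec.fst)).comp hf
    Primrec.id

theorem primrecRel_isPrefix : PrimrecRel fun a b : List Bool => a <+: b :=
  (Primrec.eq.comp Primrec.fst
    (Primrec.list_take.comp (Primrec.list_length.comp Primrec.fst) Primrec.snd)).of_eq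
    fun _ => List.prefix_iff_eq_take.symm

theorem primrecRel_comp : PrimrecRel Comp :=
  (primrecRel_isPrefix.comp Primrec.fst Primrec.snd).or
    (primrecRel_isPrefix.comp Primrec.snd Primrec.fst)

theorem primrec_rep : Primrec₂ rep :=
  Primrec.ite (primrecRel_isPrefix.comp Primrec.snd Primrec.fst) Primrec.fst Primrec.snd

theorem primrec_step : Primrec₂ step :=
  Primrec.list_append.comp
    (Primrec.list_map Primrec.fst (primrec_rep.comp
      (Primrec.fst.comp (Primrec.snd.comp Primrec.fst)) Primrec.snd))
    (Primrec.list_map Primrec.fst (primrec_rep.comp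
      (Primrec.snd.comp (Primrec.snd.comp Primrec.fst)) Primrec.snd))

theorem primrec_ev : Primrec ev := by
  have h : Primrec₂ fun (_ : List Op) (p : List (List Bool) × Op) => step p.1 p.2 :=
    primrec_step.comp (Primrec.fst.comp Primrec.snd) (Primrec.snd.comp Primrec.snd)
  exact Primrec.list_foldl Primrec.id (Primrec.const [[]]) h

theorem primrec_lo : Primrec₂ lo :=
  primrec_countP (primrec_ev.comp Primrec.fst)
    (primrecRel_isPrefix.comp (Primrec.snd.comp Primrec.fst) Primrec.snd)

theorem primrec_hi : Primrec₂ hi :=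
  primrec_countP (primrec_ev.comp Primrec.fst)
    (primrecRel_comp.comp Primrec.snd (Primrec.snd.comp Primrec.fst))

theorem primrec_above : Primrec₂ above :=
  Primrec.list_map Primrec.snd (Primrec.pair
    (Primrec.list_append.comp (Primrec.fst.comp Primrec.fst) (Primrec.fst.comp Primrec.snd))
    (Primrec.list_append.comp (Primrec.fst.comp Primrec.fst) (Primrec.snd.comp Primrec.snd)))

/-- A left fold carrying the passed prefix together with the value fits the closure properties of
`Primrec`. -/
theorem massAux_eq_foldl (L : List Bool → ℕ) (p : List Bool) (a : ℕ) (σ : List Bool) :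
    massAux L p a σ = (σ.foldl (fun q b => (q.1 ++ [b],
      if b then 4 * q.2 - min (L q.1) (4 * q.2) else min (L q.1) (4 * q.2))) (p, a)).2 := by
  induction σ generalizing p a with
  | nil => rfl
  | cons b σ ih => rw [massAux, ih]; rfl

theorem primrec_table : Primrec₂ table :=
  (Primrec.list_getD 0).comp Primrec.fst (Primrec.encode.comp Primrec.snd)

theorem primrec_massOf : Primrec₂ massOf := by
  have hq : Primrec fun p : (List ℕ × List Bool) × ((List Bool × ℕ) × Bool) => p.2.1 :=
    Primrec.fst.comp Primrec.snd
  have h4 : Primrec fun p : (List ℕ × List Bool) × ((List Bool × ℕ) × Bool) => 4 * p.2.1.2 :=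
    Primrec.nat_mul.comp (Primrec.const 4) (Primrec.snd.comp hq)
  have hm : Primrec fun p : (List ℕ × List Bool) × ((List Bool × ℕ) × Bool) =>
      min (table p.1.1 p.2.1.1) (4 * p.2.1.2) :=
    Primrec.nat_min.comp (primrec_table.comp (Primrec.fst.comp Primrec.fst)
      (Primrec.fst.comp hq)) h4
  have hb : Primrec fun p : (List ℕ × List Bool) × ((List Bool × ℕ) × Bool) => p.2.2 :=
    Primrec.snd.comp Primrec.snd
  have hstep : Primrec fun p : (List ℕ × List Bool) × ((List Bool × ℕ) × Bool) =>
      (p.2.1.1 ++ [p.2.2], if p.2.2 then 4 * p.2.1.2 - min (table p.1.1 p.2.1.1) (4 * p.2.1.2)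
        else min (table p.1.1 p.2.1.1) (4 * p.2.1.2)) :=
    Primrec.pair (Primrec.list_concat.comp (Primrec.fst.comp hq) hb)
      (Primrec.ite (Primrec.eq.comp hb (Primrec.const true)) (Primrec.nat_sub.comp h4 hm) hm)
  have : Primrec fun p : List ℕ × List Bool => (p.2.foldl (fun q b => (q.1 ++ [b],
      if b then 4 * q.2 - min (table p.1 q.1) (4 * q.2) else min (table p.1 q.1) (4 * q.2)))
        (([] : List Bool), 4)).2 :=
    Primrec.snd.comp (Primrec.list_foldl Primrec.snd (Primrec.const ([], 4)) hstep.to₂)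
  exact this.of_eq fun p => (massAux_eq_foldl (table p.1) [] 4 p.2).symm

theorem primrec_tables : Primrec tables := by
  refine Primrec.nat_rec₁ _ (Primrec.list_flatMap Primrec.snd ?_)
  refine Primrec.list_map (Primrec.list_range.comp (Primrec.succ.comp (primrec_nat_pow.comp
    (Primrec.const 4) (Primrec.nat_add.comp (Primrec.fst.comp Primrec.fst) (Primrec.const 2))))) ?_
  exact Primrec.list_concat.comp (Primrec.snd.comp Primrec.fst) Primrec.snd

theorem primrec_strings : Primrec strings :=
  Primrec.listFilterMap Primrec.list_range (Primrec.decode₂.comp Primrec.snd)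

theorem primrecRel_cons : PrimrecRel Cons := by
  have h : PrimrecPred fun p : List ℕ × List Op => ∀ σ ∈ strings p.1.length,
      lo p.2 σ * 4 ^ (σ.length + 1) ≤ 2 * massOf p.1 σ * 2 ^ p.2.length ∧
      2 * massOf p.1 σ * 2 ^ p.2.length ≤
        hi p.2 σ * 4 ^ (σ.length + 1) + 8 * 2 ^ σ.length * 2 ^ p.2.length := by
    refine PrimrecRel.forall_mem (primrec_strings.comp (Primrec.list_length.comp Primrec.fst)) ?_
    have hz : Primrec fun q : (List ℕ × List Op) × List Bool => q.1.1 :=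
      Primrec.fst.comp Primrec.fst
    have hw : Primrec fun q : (List ℕ × List Op) × List Bool => q.1.2 :=
      Primrec.snd.comp Primrec.fst
    have hσ : Primrec fun q : (List ℕ × List Op) × List Bool => q.2 := Primrec.snd
    have hl := Primrec.list_length.comp hσ
    have h4 := primrec_nat_pow.comp (Primrec.const 4) (Primrec.succ.comp hl)
    have h2w := primrec_nat_pow.comp (Primrec.const 2) (Primrec.list_length.comp hw)
    have hm := Primrec.nat_mul.comp (Primrec.nat_mul.comp (Primrec.const 2)
      (primrec_massOf.comp hz hσ)) h2w
    exact (Primrec.nat_le.comp (Primrec.nat_mul.comp (primrec_lo.comp hw hσ) h4) hm).and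
      (Primrec.nat_le.comp hm (Primrec.nat_add.comp
        (Primrec.nat_mul.comp (primrec_hi.comp hw hσ) h4)
        (Primrec.nat_mul.comp (Primrec.nat_mul.comp (Primrec.const 8)
          (primrec_nat_pow.comp (Primrec.const 2) hl)) h2w)))
  exact h.of_eq fun p => by simp only [mem_strings]; rfl

theorem primrec_weight {E : List ℕ → List Bool → Prop} (hE : PrimrecRel E) :
    Primrec (weight E) := by
  classical
  refine primrec_sum (Primrec.list_map (primrec_strings.comp Primrec.list_length) ?_)
  refine Primrec.of_eq (Primrec.ite hE ?_ (Primrec.const 0)) fun p => by congr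
  exact Primrec.nat_mul.comp primrec_massOf (primrec_nat_pow.comp (Primrec.const 4)
    (Primrec.nat_sub.comp (Primrec.list_length.comp Primrec.fst)
      (Primrec.list_length.comp Primrec.snd)))

theorem primrecRel_covered {E : List ℕ → List Bool → Prop} (hE : PrimrecRel E) (n : ℕ) :
    PrimrecRel (Covered E n) := by
  have h : PrimrecPred fun p : List ℕ × List Bool => ∃ i ∈ List.range (p.1.length + 1),
      weight E (p.1.take i) * 2 ^ n ≤ 4 ^ (i + 1) ∧
      ∃ σ ∈ strings i, E (p.1.take i) σ ∧ σ <+: p.2 := by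
    refine PrimrecRel.exists_mem
      (Primrec.list_range.comp (Primrec.succ.comp (Primrec.list_length.comp Primrec.fst))) ?_
    have ht : Primrec fun q : (List ℕ × List Bool) × ℕ => q.1.1.take q.2 :=
      Primrec.list_take.comp Primrec.snd (Primrec.fst.comp Primrec.fst)
    refine PrimrecPred.and (Primrec.nat_le.comp (Primrec.nat_mul.comp ((primrec_weight hE).comp ht)
      (Primrec.const (2 ^ n))) (primrec_nat_pow.comp (Primrec.const 4)
      (Primrec.succ.comp Primrec.snd))) ?_
    refine PrimrecRel.exists_mem (primrec_strings.comp Primrec.snd) ?_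
    exact (hE.comp (ht.comp Primrec.fst) Primrec.snd).and
      (primrecRel_isPrefix.comp Primrec.snd
        (Primrec.snd.comp (Primrec.fst.comp Primrec.fst)))
  refine h.of_eq fun p => exists_congr fun i => ?_
  rw [List.mem_range, Nat.lt_succ_iff]

theorem primrec_goodCount {Bd : List ℕ → List Bool → Prop} (hB : PrimrecRel Bd) :
    Primrec fun p : (List ℕ × List Op) × List Bool => goodCount Bd p.1.1 p.1.2 p.2 := by
  classical
  refine primrec_countP (primrec_ev.comp (Primrec.snd.comp Primrec.fst)) ?_
  exact (primrecRel_isPrefix.comp (Primrec.snd.comp Primrec.fst) Primrec.snd).and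
    (hB.comp (Primrec.fst.comp (Primrec.fst.comp Primrec.fst)) Primrec.snd).not

/-- The relation witnessing that `Forces` fails after splitting at a string. -/
theorem primrec_not_forces {Bd : List ℕ → List Bool → Prop} (hB : PrimrecRel Bd) (w : List Op)
    (N : ℕ) : PrimrecPred fun p : (List Bool × Bool) × (List Op × ℕ) =>
      ∀ z ∈ tables p.2.2,
        Cons z (w ++ [(p.1.1 ++ [p.1.2], p.1.1 ++ [!p.1.2])] ++
          above (p.1.1 ++ [p.1.2]) p.2.1) →
        N * goodCount Bd z (w ++ [(p.1.1 ++ [p.1.2], p.1.1 ++ [!p.1.2])] ++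
          above (p.1.1 ++ [p.1.2]) p.2.1) (p.1.1 ++ [p.1.2]) <
        2 ^ (w ++ [(p.1.1 ++ [p.1.2], p.1.1 ++ [!p.1.2])] ++
          above (p.1.1 ++ [p.1.2]) p.2.1).length := by
  refine PrimrecRel.forall_mem (primrec_tables.comp (Primrec.snd.comp Primrec.snd)) ?_
  have hv : Primrec fun p : (List Bool × Bool) × (List Op × ℕ) => p.1.1 ++ [p.1.2] :=
    Primrec.list_concat.comp (Primrec.fst.comp Primrec.fst) (Primrec.snd.comp Primrec.fst)
  have hv' : Primrec fun p : (List Bool × Bool) × (List Op × ℕ) => p.1.1 ++ [!p.1.2] :=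
    Primrec.list_concat.comp (Primrec.fst.comp Primrec.fst)
      (Primrec.not.comp (Primrec.snd.comp Primrec.fst))
  have hW : Primrec fun p : (List Bool × Bool) × (List Op × ℕ) =>
      w ++ [(p.1.1 ++ [p.1.2], p.1.1 ++ [!p.1.2])] ++ above (p.1.1 ++ [p.1.2]) p.2.1 :=
    Primrec.list_append.comp (Primrec.list_concat.comp (Primrec.const w) (Primrec.pair hv hv'))
      (primrec_above.comp hv (Primrec.fst.comp Primrec.snd))
  have hW' := hW.comp (Primrec.fst (β := List ℕ))
  refine (((primrecRel_cons.comp Primrec.snd hW').not).or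
    (Primrec.nat_lt.comp (Primrec.nat_mul.comp (Primrec.const N)
      ((primrec_goodCount hB).comp ((Primrec.snd.pair hW').pair (hv.comp Primrec.fst))))
      (primrec_nat_pow.comp (Primrec.const 2) (Primrec.list_length.comp hW')))).of_eq fun p => ?_
  exact imp_iff_not_or.symm

end Primrec

/-! ### Using that x is not computable. -/

/-- The initial segment of length `n` of `x`. -/
def pre (x : Cantor) (n : ℕ) : List Bool :=
  (List.range n).map x

theorem pre_succ (x : Cantor) (n : ℕ) : pre x (n + 1) = pre x n ++ [x n] := by
  simp [pre, List.range_succ]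

theorem length_pre (x : Cantor) (n : ℕ) : (pre x n).length = n := by simp [pre]

theorem pre_prefix (x : Cantor) {m n : ℕ} (h : m ≤ n) : pre x m <+: pre x n := by
  induction n, h using Nat.le_induction with
  | base => exact List.prefix_refl _
  | succ n _ ih => rw [pre_succ]; exact ih.trans (List.prefix_append _ _)

theorem getElem?_pre (x : Cantor) {m n : ℕ} (h : m < n) : (pre x n)[m]? = some (x m) := by
  simp [pre, h]

/-- A real is computable if its next bit can be found by a search. -/
theorem computable_of_search {κ : Type*} [Primcodable κ] (x : Cantor) (m : ℕ)
    {P : (List Bool × Bool) × κ → Prop} (hP : PrimrecPred P)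
    (h : ∀ n ≥ m, ∀ b, (∃ k, P ((pre x n, b), k)) ↔ b = x n) : Computable x := by
  classical
  -- The number `i` codes a possible witness, tried for both bits; no wrong bit has a witness.
  set f : List Bool → ℕ → Option Bool := fun τ i => (Encodable.decode i : Option κ).bind fun k =>
    if P ((τ, true), k) then some true else if P ((τ, false), k) then some false else none with hf
  have hf' : Primrec₂ f := by
    refine Primrec.option_bind (Primrec.decode.comp Primrec.snd) ?_
    have hc : ∀ b, PrimrecPred fun q : (List Bool × ℕ) × κ => P ((q.1.1, b), q.2) := fun b =>
      hP.comp (Primrec.pair (Primrec.pair (Primrec.fst.comp Primrec.fst) (Primrec.const b))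
        Primrec.snd)
    exact Primrec.ite (hc true) (Primrec.const _)
      (Primrec.ite (hc false) (Primrec.const _) (Primrec.const _))
  have hsearch : ∀ n ≥ m, Nat.rfindOpt (f (pre x n)) = Part.some (x n) := by
    intro n hn
    have hsound : ∀ i b, b ∈ f (pre x n) i → b = x n := by
      intro i b hb
      obtain ⟨k, -, hb⟩ := Option.bind_eq_some_iff.1 hb
      refine (h n hn b).1 ⟨k, ?_⟩
      split_ifs at hb with h₁ h₂
      · cases hb; exact h₁
      · cases hb; exact h₂
    obtain ⟨k, hk⟩ := (h n hn (x n)).2 rfl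
    have hdom : (Nat.rfindOpt (f (pre x n))).Dom := by
      rw [Nat.rfindOpt_dom]
      refine ⟨Encodable.encode k, ?_⟩
      simp only [hf, Encodable.encodek, Option.bind_some]
      by_cases h₁ : P ((pre x n, true), k)
      · exact ⟨true, by simp [h₁]⟩
      · cases hx : x n
        · rw [hx] at hk; exact ⟨false, by simp [h₁, hk]⟩
        · rw [hx] at hk; exact (h₁ hk).elim
    obtain ⟨b, hb⟩ := Part.dom_iff_mem.1 hdom
    obtain ⟨i, hi⟩ := Nat.rfindOpt_spec hb
    rw [Part.eq_some_iff, ← hsound i b hi]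
    exact hb
  -- The first `m` bits are built in as a constant; each further bit is found by the search.
  have hpath : Computable fun n => pre x (m + n) := by
    have h₁ : Partrec₂ fun (_ : ℕ) (q : ℕ × List Bool) =>
        (Nat.rfindOpt (f q.2)).map fun b => q.2 ++ [b] := by
      have h₂ : Partrec fun q : ℕ × (ℕ × List Bool) => Nat.rfindOpt (f q.2.2) :=
        (Partrec.rfindOpt hf'.to_comp).comp (Computable.snd.comp Computable.snd)
      refine h₂.map (Computable.list_concat.comp
        (Computable.snd.comp (Computable.snd.comp Computable.fst)) Computable.snd)
    refine (Partrec.nat_rec Computable.id (Computable.const (pre x m)).partrec h₁).of_eq_tot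
      fun n => ?_
    induction n with
    | zero => simp
    | succ n ih =>
      refine Part.mem_bind ih ?_
      rw [hsearch _ (by omega), ← add_assoc, pre_succ]
      simp
  have hget : Computable fun n => (pre x (m + (n + 1)))[n]?.getD false :=
    Computable.option_getD (Computable.list_getElem?.comp (hpath.comp Computable.succ)
      Computable.id) (Computable.const false)
  exact hget.of_eq fun n => by rw [getElem?_pre x (by omega)]; rfl

theorem mem_ev_swap (w : List Op) (a b y : List Bool) :
    y ∈ ev (w ++ [(a, b)]) ↔ y ∈ ev (w ++ [(b, a)]) := by
  simp only [ev_append_singleton, step, List.mem_append]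
  exact or_comm

theorem hi_swap (w : List Op) (a b σ : List Bool) :
    hi (w ++ [(a, b)]) σ = hi (w ++ [(b, a)]) σ := by
  simp only [hi, countP_ev_append_singleton]
  exact add_comm _ _

/-- If `x` is not computable, then one of the two ways of splitting above some initial segment
of `x` preserves `Forces`. -/
theorem exists_split {x : Cantor} (hx : ¬ Computable x) {Bd : List ℕ → List Bool → Prop}
    (hB : Increasing Bd) (hP : PrimrecRel Bd) {w : List Op} {j N : ℕ}
    (h : Forces Bd w (pre x j) N) (hw : Focused w (pre x j)) :
    ∃ (t : List Op) (i : ℕ), j < i ∧ Forces Bd (w ++ t) (pre x i) (2 * N) ∧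
      Focused (w ++ t) (pre x i) ∧
      hi (w ++ t) (pre x i) * 2 ≤ 2 ^ t.length * hi w (pre x j) := by
  by_cases hA : ∃ i ≥ j, Forces Bd (w ++ [(pre x i ++ [x i], pre x i ++ [!x i])])
      (pre x i ++ [x i]) (2 * N)
  · obtain ⟨i, hi, hF⟩ := hA
    obtain ⟨h₁, -, h₂⟩ := hw.split (pre_prefix x hi) (x i)
    refine ⟨[(pre x i ++ [x i], pre x i ++ [!x i])], i + 1, Nat.lt_succ_of_le hi, ?_, ?_, ?_⟩
    · rw [pre_succ]; exact hF
    · rw [pre_succ]; exact h₁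
    · rw [pre_succ, List.length_singleton, pow_one, mul_comm]
      exact Nat.mul_le_mul_left 2 h₂
  by_cases hC : ∃ i ≥ j, ¬ Forces Bd (w ++ [(pre x i ++ [!x i], pre x i ++ [x i])])
      (pre x i ++ [!x i]) (2 * N)
  · obtain ⟨i, hi, hF⟩ := hC
    obtain ⟨t, ht⟩ := h.split hB hw (pre_prefix x hi) (x i) hF
    obtain ⟨h₁, -, h₂⟩ := hw.split (pre_prefix x hi) (x i)
    have h₁' : Focused (w ++ [(pre x i ++ [!x i], pre x i ++ [x i])]) (pre x i ++ [x i]) :=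
      fun y hy => h₁ y ((mem_ev_swap w _ _ y).1 hy)
    rw [hi_swap] at h₂
    refine ⟨[(pre x i ++ [!x i], pre x i ++ [x i])] ++ above (pre x i ++ [!x i]) t, i + 1,
      Nat.lt_succ_of_le hi, ?_, ?_, ?_⟩
    · rw [pre_succ, ← List.append_assoc]; exact ht
    · rw [pre_succ, ← List.append_assoc]; exact h₁'.above (not_comp_siblings _ _) t
    · have h₃ := hi_append_le (w ++ [(pre x i ++ [!x i], pre x i ++ [x i])])
        (above (pre x i ++ [!x i]) t) (pre x i ++ [x i])
      rw [pre_succ, ← List.append_assoc, List.length_append, List.length_singleton, pow_add,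
        pow_one]
      calc _ ≤ (2 ^ (above (pre x i ++ [!x i]) t).length * _root_.hi w (pre x j)) * 2 :=
            Nat.mul_le_mul_right 2 (h₃.trans (Nat.mul_le_mul_left _ h₂))
        _ = _ := by ring
  -- Beyond `j`, the relation fails on the side of `x` and holds on the other side. Failure has a
  -- witness `(t, s)` checked against finitely many tables, so searching for it computes `x`.
  · push Not at hA hC
    refine (hx (computable_of_search x j (primrec_not_forces hP w (2 * N)) fun i hi b => ?_)).elim
    have key : (∃ k : List Op × ℕ, ∀ z ∈ tables k.2,
        Cons z (w ++ [(pre x i ++ [b], pre x i ++ [!b])] ++ above (pre x i ++ [b]) k.1) →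
        2 * N * goodCount Bd z (w ++ [(pre x i ++ [b], pre x i ++ [!b])] ++
          above (pre x i ++ [b]) k.1) (pre x i ++ [b]) <
        2 ^ (w ++ [(pre x i ++ [b], pre x i ++ [!b])] ++ above (pre x i ++ [b]) k.1).length) ↔
        ¬ Forces Bd (w ++ [(pre x i ++ [b], pre x i ++ [!b])]) (pre x i ++ [b]) (2 * N) := by
      unfold Forces
      push Not
      exact ⟨fun ⟨k, hk⟩ => ⟨k.1, k.2, hk⟩, fun ⟨t, s, hk⟩ => ⟨(t, s), hk⟩⟩
    refine key.trans ⟨fun hS => ?_, ?_⟩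
    · by_contra hb
      obtain rfl : b = !x i := by revert hb; cases b <;> cases x i <;> decide
      rw [Bool.not_not] at hS
      exact hS (hC i hi)
    · rintro rfl
      exact hA i hi

/-! ### The construction by stages and its limit. -/

/-- A stage of the construction. -/
structure Stage where
  /-- the operations carried out so far -/
  ops : List Op
  /-- the length of the initial segment of `x` considered -/
  len : ℕ
  /-- the reciprocal of the proportion of good strings -/
  bound : ℕ
  /-- the strings to be avoided -/
  bad : List ℕ → List Bool → Prop

/-- The invariant of the construction at step `k`. -/
structure Stage.Good (x : Cantor) (k : ℕ) (S : Stage) : Prop where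
  increasing : Increasing S.bad
  primrec : PrimrecRel S.bad
  forces : Forces S.bad S.ops (pre x S.len) S.bound
  focused : Focused S.ops (pre x S.len)
  le_len : k ≤ S.len
  hi_le : hi S.ops (pre x S.len) * 2 ^ k ≤ 2 ^ S.ops.length

theorem Stage.good_zero (x : Cantor) : Stage.Good x 0 ⟨[], 0, 1, fun _ _ => False⟩ where
  increasing := fun _ _ _ _ h => h
  primrec := (PrimrecPred.not (Primrec.eq.comp (Primrec.const 0) (Primrec.const 0))).of_eq
    fun _ => by simp
  forces := forces_initial
  focused := by simp [Focused, ev_nil, pre]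
  le_len := le_rfl
  hi_le := by simp [hi, ev_nil, Comp]

theorem Stage.Good.exists_next {x : Cantor} (hx : ¬ Computable x) {k : ℕ} {S : Stage}
    (hS : S.Good x k) {E : ℕ → List ℕ → List Bool → Prop} (hE : ∀ n, Increasing (E n))
    (hP : ∀ n, PrimrecRel (E n)) :
    ∃ S' : Stage, S'.Good x (k + 1) ∧ S.ops <+: S'.ops ∧
      S'.bad = fun z y => S.bad z y ∨ Covered (E (4 * S.bound)) (4 * S.bound) z y := by
  have hB : Increasing fun z y => S.bad z y ∨ Covered (E (4 * S.bound)) (4 * S.bound) z y :=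
    fun z z' h y => Or.imp (hS.increasing h y) (Covered.increasing _ _ h y)
  have hB' : PrimrecRel fun z y => S.bad z y ∨ Covered (E (4 * S.bound)) (4 * S.bound) z y :=
    hS.primrec.or (primrecRel_covered (hP _) _)
  -- The level `4 * S.bound` is admissible for the new test because m ≤ 2^m.
  obtain ⟨t, i, hi, h₁, h₂, h₃⟩ := exists_split hx hB hB'
    (hS.forces.or_covered (hE (4 * S.bound)) Nat.lt_two_pow_self.le) hS.focused
  refine ⟨⟨S.ops ++ t, i, _, _⟩, ⟨hB, hB', h₁, h₂, Nat.succ_le_of_lt (hS.le_len.trans_lt hi), ?_⟩,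
    List.prefix_append _ _, rfl⟩
  have h₄ := hS.hi_le
  simp only [List.length_append, pow_add, pow_one]
  calc _ = (_root_.hi (S.ops ++ t) (pre x i) * 2) * 2 ^ k := by ring
    _ ≤ (2 ^ t.length * _root_.hi S.ops (pre x S.len)) * 2 ^ k := Nat.mul_le_mul_right _ h₃
    _ = 2 ^ t.length * (_root_.hi S.ops (pre x S.len) * 2 ^ k) := by ring
    _ ≤ 2 ^ t.length * 2 ^ S.ops.length := Nat.mul_le_mul_left _ h₄
    _ = _ := mul_comm _ _

/-- A positive proportion of good strings provides at least one, and by focus it is the current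
initial segment of `x` itself. -/
theorem Stage.Good.exists_table {x : Cantor} {k : ℕ} {S : Stage} (hS : S.Good x k) (s : ℕ) :
    ∃ z ∈ tables s, Cons z S.ops ∧ ¬ S.bad z (pre x S.len) := by
  classical
  obtain ⟨z, hz, hc, hg⟩ := hS.forces [] s
  simp only [above, List.map_nil, List.append_nil] at hc hg
  refine ⟨z, hz, hc, ?_⟩
  have hpos : 0 < goodCount S.bad z S.ops (pre x S.len) := by
    by_contra h0
    rw [Nat.eq_zero_of_not_pos h0, mul_zero] at hg
    exact absurd hg (Nat.not_le.2 (by positivity))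
  obtain ⟨y, hy, hy'⟩ := List.countP_pos_iff.1 hpos
  simp only [decide_eq_true_eq] at hy'
  rw [← hS.focused y hy (Or.inr hy'.1)]
  exact hy'.2

theorem getD_le_of_mem_tables {s : ℕ} {z : List ℕ} (h : z ∈ tables s) (i : ℕ) :
    z.getD i 0 ≤ 4 ^ (i + 2) := by
  induction s generalizing z with
  | zero => simp [tables] at h; simp [h]
  | succ s ih =>
    obtain ⟨z', hz', j, hj, rfl⟩ := mem_tables_succ.1 h
    have hl := length_of_mem_tables hz'
    rcases lt_trichotomy i s with hi | rfl | hi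
    · rw [List.getD_append _ _ _ _ (by omega)]
      exact ih hz'
    · simpa [List.getD, List.getElem?_append_right, hl] using hj
    · rw [List.getD_eq_default _ _ (by simp; omega)]
      positivity

/-- The list of the first `s` values of `Z`. -/
def initial (Z : ℕ → ℕ) (s : ℕ) : List ℕ :=
  (List.range s).map Z

/-- A sequence of tables of increasing length has a limit point. -/
theorem exists_limit {z : ℕ → List ℕ} (hz : ∀ k, z k ∈ tables k) :
    ∃ Z : ℕ → ℕ, ∀ s m, ∃ k ≥ m, initial Z s <+: z k := by
  set F := Filter.hyperfilter ℕ
  have h₁ : ∀ i, ∃ v, ∀ᶠ k in F, (z k).getD i 0 = v := by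
    intro i
    -- Each entry takes boundedly many values, so the ultrafilter selects one of them.
    have hfin : (Set.Iic (4 ^ (i + 2)) : Set ℕ) ∈ F.map fun k => (z k).getD i 0 :=
      Ultrafilter.mem_map.2 (Filter.univ_mem' fun k => getD_le_of_mem_tables (hz k) i)
    obtain ⟨v, -, hv⟩ := Ultrafilter.eq_pure_of_finite_mem (Set.finite_Iic _) hfin
    refine ⟨v, ?_⟩
    have : ({v} : Set ℕ) ∈ F.map fun k => (z k).getD i 0 := by rw [hv]; exact rfl
    exact this
  choose Z hZ using h₁
  refine ⟨Z, fun s m => ?_⟩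
  have hge : ∀ n, ∀ᶠ k in (F : Filter ℕ), n ≤ k := fun n =>
    (Filter.eventually_ge_atTop n).filter_mono Nat.hyperfilter_le_atTop
  have hs : ∀ᶠ k in (F : Filter ℕ), ∀ i ∈ Finset.range s, (z k).getD i 0 = Z i :=
    (Finset.eventually_all _).2 fun i _ => hZ i
  obtain ⟨k, ⟨hk₁, hk₂⟩, hk₃⟩ := ((hs.and (hge s)).and (hge m)).exists
  refine ⟨k, hk₃, ?_⟩
  rw [List.prefix_iff_eq_take]
  refine List.ext_getElem (by simp [initial, length_of_mem_tables (hz k), hk₂]) fun i hi _ => ?_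
  have hi' : i < s := by simpa [initial] using hi
  have := hk₁ i (Finset.mem_range.2 hi')
  rw [List.getD_eq_getElem _ _ (by rw [length_of_mem_tables (hz k)]; omega)] at this
  simp [initial, this]

/-- The function constructed from a noncomputable `x` that is going to name the measure. -/
theorem exists_generic {x : Cantor} (hx : ¬ Computable x) {E : ℕ → ℕ → List ℕ → List Bool → Prop}
    (hE : ∀ c n, Increasing (E c n)) (hP : ∀ c n, PrimrecRel (E c n)) :
    ∃ Z : ℕ → ℕ,
      (∀ k, ∃ (w : List Op) (j : ℕ), k ≤ j ∧ hi w (pre x j) * 2 ^ k ≤ 2 ^ w.length ∧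
        ∀ s, Cons (initial Z s) w) ∧
      ∀ c, ∃ n, ∀ s j, ¬ Covered (E c n) n (initial Z s) (pre x j) := by
  have : Nonempty Stage := ⟨⟨[], 0, 1, fun _ _ => False⟩⟩
  have hnext : ∀ k (S : Stage), ∃ S' : Stage, S.Good x k → S'.Good x (k + 1) ∧ S.ops <+: S'.ops ∧
      S'.bad = fun z y => S.bad z y ∨ Covered (E k (4 * S.bound)) (4 * S.bound) z y := by
    intro k S
    by_cases hS : S.Good x k
    · obtain ⟨S', h⟩ := hS.exists_next hx (hE k) (hP k)
      exact ⟨S', fun _ => h⟩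
    · exact ⟨S, fun h => (hS h).elim⟩
  choose f hf using hnext
  set S : ℕ → Stage := fun k => k.rec ⟨[], 0, 1, fun _ _ => False⟩ f with hSdef
  have hS : ∀ k, (S k).Good x k := by
    intro k
    induction k with
    | zero => exact Stage.good_zero x
    | succ k ih => exact (hf k _ ih).1
  have hops : ∀ k m, k ≤ m → (S k).ops <+: (S m).ops := by
    intro k m h
    induction m, h using Nat.le_induction with
    | base => exact List.prefix_refl _
    | succ m _ ih => exact ih.trans (hf m _ (hS m)).2.1
  have hbad : ∀ k m, k < m → ∀ z y,
      Covered (E k (4 * (S k).bound)) (4 * (S k).bound) z y → (S m).bad z y := by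
    intro k m h z y hc
    induction m, Nat.succ_le_of_lt h using Nat.le_induction with
    | base =>
      have e := (hf k _ (hS k)).2.2
      change (f k (S k)).bad z y
      rw [e]; exact Or.inr hc
    | succ m hm ih =>
      have e := (hf m _ (hS m)).2.2
      change (f m (S m)).bad z y
      rw [e]; exact Or.inl (ih hm)
  choose z hz hc hg using fun k => (hS k).exists_table k
  obtain ⟨Z, hZ⟩ := exists_limit hz
  refine ⟨Z, fun k => ⟨(S k).ops, (S k).len, (hS k).le_len, (hS k).hi_le, fun s => ?_⟩, fun c =>
    ⟨4 * (S c).bound, fun s j hcov => ?_⟩⟩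
  -- Consistency with the operations of a later stage passes down to those of stage `k` and to
  -- shorter tables.
  · obtain ⟨m, hm, hpre⟩ := hZ s k
    obtain ⟨t, ht⟩ := hops k m hm
    have := hc m
    rw [← ht] at this
    exact this.of_append.of_prefix_left hpre
  -- Stage `m` is late enough to have treated the test `c` and to consider an initial segment of
  -- length at least `j`.
  · obtain ⟨m, hm, hpre⟩ := hZ s (max (c + 1) j)
    refine hg m (hbad c m (by omega) _ _ ?_)
    obtain ⟨i, h₁, h₂, σ, h₃, h₄, h₅⟩ := Covered.increasing _ _ hpre _ hcov
    exact ⟨i, h₁, h₂, σ, h₃, h₄, h₅.trans (pre_prefix x (by have := (hS m).le_len; omega))⟩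

/-! ### Measures on Cantor space with prescribed values on cylinders. -/

theorem mem_cyl {x : Cantor} {σ : List Bool} : x ∈ cyl σ ↔ pre x σ.length = σ := Iff.rfl

theorem measurableSet_cyl (σ : List Bool) : MeasurableSet (cyl σ) := by
  have : cyl σ = ⋂ i : Fin σ.length, (fun x : Cantor => x i) ⁻¹' {σ[i]} := by
    ext x
    simp only [Set.mem_iInter, Set.mem_preimage, Set.mem_singleton_iff, mem_cyl]
    refine ⟨fun h i => ?_, fun h => List.ext_getElem (length_pre x _) fun i hi hi' => ?_⟩
    · have := getElem?_pre x i.2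
      rw [h] at this
      simpa using this.symm
    · simpa [pre] using h ⟨i, hi'⟩
  rw [this]
  exact MeasurableSet.iInter fun i => measurable_pi_apply _ (measurableSet_singleton _)

section CylinderMeasure

variable (m : List Bool → ℝ)

/-- The left end point of the interval assigned to `σ` when `[0, 1)` is divided in the
proportions given by `m`. -/
def leftEnd (σ : List Bool) : ℝ :=
  ∑ i ∈ Finset.range σ.length, if σ[i]? = some true then m (σ.take i ++ [false]) else 0

theorem leftEnd_append_singleton (σ : List Bool) (b : Bool) :
    leftEnd m (σ ++ [b]) = leftEnd m σ + if b then m (σ ++ [false]) else 0 := by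
  rw [leftEnd, List.length_append, List.length_singleton, Finset.sum_range_succ]
  congr 1
  · refine Finset.sum_congr rfl fun i hi => ?_
    have hi' : i < σ.length := Finset.mem_range.1 hi
    rw [List.getElem?_append_left hi', List.take_append_of_le_length hi'.le]
  · simp

/-- The interval assigned to `σ` when `[0, 1)` is divided in the proportions given by `m`. -/
def interval (σ : List Bool) : Set ℝ :=
  Set.Ico (leftEnd m σ) (leftEnd m σ + m σ)

open Classical in
/-- The real whose initial segments are assigned intervals containing `t`. -/
noncomputable def pathOf (t : ℝ) : Cantor :=
  fun n => decide (∃ σ : List Bool, σ.length = n ∧ t ∈ interval m (σ ++ [true]))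

theorem measurable_pathOf : Measurable (pathOf m) := by
  refine measurable_pi_iff.2 fun n => measurable_to_bool ?_
  have : (fun t => pathOf m t n) ⁻¹' {true} =
      ⋃ σ ∈ {σ : List Bool | σ.length = n}, interval m (σ ++ [true]) := by
    ext t; simp [pathOf]
  rw [this]
  exact MeasurableSet.biUnion (Set.to_countable _) fun σ _ => measurableSet_Ico

variable {m}

/-- The intervals of the two children partition the interval of their parent. By induction exactly
one string of each length has `t` in its interval, and `pathOf` reads it off. -/
theorem pre_pathOf_eq_iff (h0 : ∀ σ, 0 ≤ m σ) (h1 : m [] = 1)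
    (hadd : ∀ σ, m (σ ++ [false]) + m (σ ++ [true]) = m σ) {t : ℝ} (ht : t ∈ Set.Ico (0 : ℝ) 1)
    (σ : List Bool) : pre (pathOf m t) σ.length = σ ↔ t ∈ interval m σ := by
  have hsub : ∀ σ, t ∈ interval m (σ ++ [true]) → t ∈ interval m σ := by
    intro σ h
    have h₁ := h0 (σ ++ [false])
    have h₂ := hadd σ
    simp only [interval, leftEnd_append_singleton, Set.mem_Ico, if_true] at h ⊢
    constructor <;> linarith [h.1, h.2]
  have key : ∀ n, ∀ σ : List Bool, σ.length = n →
      (pre (pathOf m t) n = σ ↔ t ∈ interval m σ) := by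
    intro n
    induction n with
    | zero =>
      intro σ hl
      rw [List.length_eq_zero_iff.1 hl]
      simpa [pre, interval, leftEnd, h1] using ht
    | succ n ih =>
      intro σ hl
      obtain ⟨σ, b, rfl⟩ := (List.eq_nil_or_concat' σ).resolve_left
        (List.ne_nil_of_length_eq_add_one hl)
      have hl' : σ.length = n := by simpa using hl
      have hbit : t ∈ interval m σ → (pathOf m t n = true ↔ t ∈ interval m (σ ++ [true])) := by
        intro hσ
        simp only [pathOf, decide_eq_true_eq]
        refine ⟨fun ⟨σ', h, hσ'⟩ => ?_, fun h => ⟨σ, hl', h⟩⟩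
        rwa [← (ih σ hl').2 hσ, (ih σ' h).2 (hsub σ' hσ')]
      have hsplit : t ∈ interval m σ → (t ∈ interval m (σ ++ [false]) ↔
          ¬ t ∈ interval m (σ ++ [true])) := by
        intro hσ
        have h₂ := hadd σ
        simp only [interval, leftEnd_append_singleton, Set.mem_Ico, if_true, Bool.false_eq_true,
          if_false, add_zero] at hσ ⊢
        rw [add_assoc, h₂, not_and_or, not_le, not_lt]
        exact ⟨fun h => Or.inl h.2, fun h => ⟨hσ.1, h.resolve_right (not_le.2 hσ.2)⟩⟩
      have hsub' : t ∈ interval m (σ ++ [b]) → t ∈ interval m σ := by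
        cases b
        · intro h
          have h₁ := h0 (σ ++ [true])
          have h₂ := hadd σ
          simp only [interval, leftEnd_append_singleton, Set.mem_Ico, Bool.false_eq_true,
            if_false, add_zero] at h ⊢
          constructor <;> linarith [h.1, h.2]
        · exact hsub σ
      have happ : ∀ l : List Bool, ∀ c, l ++ [c] = σ ++ [b] ↔ l = σ ∧ c = b := by simp
      rw [pre_succ, happ, ih σ hl']
      refine ⟨fun ⟨h₁, h₂⟩ => ?_, fun h => ⟨hsub' h, ?_⟩⟩
      · cases b
        · rw [hsplit h₁, ← hbit h₁, h₂]; simp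
        · exact (hbit h₁).1 h₂
      · cases b
        · have h' := hsub' h
          rw [hsplit h', ← hbit h'] at h; simpa using h
        · exact (hbit (hsub' h)).2 h
  exact key _ σ rfl

/-- The measure is the image of Lebesgue measure on [0, 1) under `pathOf`: the preimage of a
cylinder is an interval of the prescribed length. -/
theorem exists_measure (h0 : ∀ σ, 0 ≤ m σ) (h1 : m [] = 1)
    (hadd : ∀ σ, m (σ ++ [false]) + m (σ ++ [true]) = m σ) :
    ∃ μ : ProbabilityMeasure Cantor, ∀ σ, (μ : Measure Cantor).real (cyl σ) = m σ := by
  have hI : IsProbabilityMeasure ((volume : Measure ℝ).restrict (Set.Ico 0 1)) :=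
    ⟨by simp⟩
  refine ⟨⟨((volume : Measure ℝ).restrict (Set.Ico 0 1)).map (pathOf m),
    Measure.isProbabilityMeasure_map (measurable_pathOf m).aemeasurable⟩, fun σ => ?_⟩
  have hsub : interval m σ ⊆ Set.Ico 0 1 := by
    induction σ using List.reverseRecOn with
    | nil => simp [interval, leftEnd, h1]
    | append_singleton σ b ih =>
      refine Set.Subset.trans (Set.Ico_subset_Ico ?_ ?_) ih <;>
      · have h₁ := h0 (σ ++ [true])
        have h₂ := h0 (σ ++ [false])
        have h₃ := hadd σ
        rw [leftEnd_append_singleton]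
        cases b <;> simp <;> linarith
  have hpre : pathOf m ⁻¹' cyl σ ∩ Set.Ico 0 1 = interval m σ := by
    ext t
    refine ⟨fun h => (pre_pathOf_eq_iff h0 h1 hadd h.2 σ).1 h.1, fun h =>
      ⟨(pre_pathOf_eq_iff h0 h1 hadd (hsub h) σ).2 h, hsub h⟩⟩
  rw [ProbabilityMeasure.coe_mk, map_measureReal_apply (measurable_pathOf m) (measurableSet_cyl σ),
    measureReal_restrict_apply ((measurable_pathOf m) (measurableSet_cyl σ)), hpre, interval,
    Real.volume_real_Ico_of_le (by linarith [h0 σ])]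
  ring

end CylinderMeasure

/-! ### The measure named by an infinite table. -/

/-- The numerator at `σ` of the measure named by `Z`. -/
def numer (Z : ℕ → ℕ) (σ : List Bool) : ℕ :=
  mass (fun τ => Z (Encodable.encode τ)) σ

/-- The measure `μ` is the one named by `Z`. -/
def Names (Z : ℕ → ℕ) (μ : Measure Cantor) : Prop :=
  ∀ σ, μ.real (cyl σ) = (numer Z σ : ℝ) / 4 ^ (σ.length + 1)

theorem exists_names (Z : ℕ → ℕ) : ∃ μ : ProbabilityMeasure Cantor, Names Z μ := by
  refine exists_measure (fun σ => by positivity) ?_ fun σ => ?_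
  · simp [numer, mass_nil]
  · have h := mass_children (fun τ => Z (Encodable.encode τ)) σ
    have h' : (numer Z (σ ++ [false]) : ℝ) + numer Z (σ ++ [true]) = 4 * numer Z σ := by
      exact_mod_cast h
    rw [List.length_append, List.length_append, List.length_singleton, List.length_singleton,
      ← add_div, h', pow_succ _ (σ.length + 1), mul_comm, mul_div_mul_right _ _ (by norm_num)]

theorem length_initial (Z : ℕ → ℕ) (s : ℕ) : (initial Z s).length = s := by simp [initial]

theorem initial_prefix (Z : ℕ → ℕ) {s s' : ℕ} (h : s ≤ s') : initial Z s <+: initial Z s' := by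
  obtain ⟨k, rfl⟩ := Nat.exists_eq_add_of_le h
  rw [initial, initial, List.range_add, List.map_append]
  exact List.prefix_append _ _

theorem take_initial (Z : ℕ → ℕ) {s s' : ℕ} (h : s ≤ s') :
    (initial Z s').take s = initial Z s := by
  have := List.prefix_iff_eq_take.1 (initial_prefix Z h)
  rw [length_initial] at this
  exact this.symm

theorem massOf_initial (Z : ℕ → ℕ) {s : ℕ} {σ : List Bool} (h : Encodable.encode σ < s) :
    massOf (initial Z s) σ = numer Z σ :=
  mass_congr fun τ hτ => by
    rw [table, initial, List.getD_eq_getElem _ _ (by simpa using hτ.trans h)]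
    simp

/-- If the measure named by `Z` is consistent with lists that contain few strings comparable to
initial segments of `x`, then it vanishes at `x`. -/
theorem Names.measure_singleton {Z : ℕ → ℕ} {μ : Measure Cantor} [IsProbabilityMeasure μ]
    (hZ : Names Z μ) {x : Cantor}
    (h : ∀ k, ∃ (w : List Op) (j : ℕ), k ≤ j ∧ hi w (pre x j) * 2 ^ k ≤ 2 ^ w.length ∧
        ∀ s, Cons (initial Z s) w) : μ {x} = 0 := by
  have hbound : ∀ k : ℕ, μ.real {x} ≤ 2 * (1 / 2) ^ k := by
    intro k
    obtain ⟨w, j, hkj, hw, hc⟩ := h k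
    have hx : ({x} : Set Cantor) ⊆ cyl (pre x j) := by
      rintro _ rfl
      rw [mem_cyl, length_pre]
    refine (measureReal_mono hx).trans ?_
    rw [hZ]
    have h₂ := (hc (Encodable.encode (pre x j) + 1) (pre x j) (by simp [length_initial])).2
    rw [massOf_initial Z (Nat.lt_succ_self _), length_pre] at h₂
    rw [length_pre]
    have h₂' : 2 * (numer Z (pre x j) : ℝ) * 2 ^ w.length ≤
        hi w (pre x j) * 4 ^ (j + 1) + 8 * 2 ^ j * 2 ^ w.length := by exact_mod_cast h₂
    have hw' : (hi w (pre x j) : ℝ) * 2 ^ k ≤ 2 ^ w.length := by exact_mod_cast hw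
    have hk : (2 : ℝ) ^ k ≤ 2 ^ j := pow_le_pow_right₀ (by norm_num) hkj
    have e : (4 : ℝ) ^ (j + 1) = 4 * (2 ^ j * 2 ^ j) := by
      rw [pow_succ, ← mul_pow]; norm_num [mul_comm]
    rw [div_le_iff₀ (by positivity), one_div, inv_pow, e]
    rw [e] at h₂'
    have hp : (0 : ℝ) < 2 ^ k := by positivity
    have hj : (0 : ℝ) < 2 ^ j := by positivity
    have hl : (0 : ℝ) < 2 ^ w.length := by positivity
    set J : ℝ := 2 ^ j
    set K : ℝ := 2 ^ k
    set N : ℝ := 2 ^ w.length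
    set H : ℝ := (hi w (pre x j) : ℝ)
    set M : ℝ := (numer Z (pre x j) : ℝ)
    have h₃ : 2 * M * N * K ≤ 4 * (J * J) * N + 8 * J * N * K := by
      calc 2 * M * N * K ≤ (H * (4 * (J * J)) + 8 * J * N) * K :=
            mul_le_mul_of_nonneg_right h₂' hp.le
        _ = (H * K) * (4 * (J * J)) + 8 * J * N * K := by ring
        _ ≤ N * (4 * (J * J)) + 8 * J * N * K := by gcongr
        _ = _ := by ring
    -- The error term is absorbed because `k ≤ j`: the segment is at least as long as the number of
    -- halvings.
    have h₄ : M * K ≤ 8 * (J * J) := by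
      have h₅ : J * K ≤ J * J := mul_le_mul_of_nonneg_left hk hj.le
      have h₆ : N * (M * K) ≤ N * (2 * (J * J) + 4 * (J * K)) := by linarith
      have := le_of_mul_le_mul_left h₆ hl
      nlinarith
    calc M = M * K * K⁻¹ := by field_simp
      _ ≤ 8 * (J * J) * K⁻¹ := by gcongr
      _ = _ := by ring
  have hlim : Filter.Tendsto (fun k : ℕ => 2 * (1 / 2 : ℝ) ^ k) Filter.atTop (nhds 0) := by
    simpa using (tendsto_pow_atTop_nhds_zero_of_lt_one (r := (1 / 2 : ℝ)) (by norm_num)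
      (by norm_num)).const_mul 2
  have h0 : μ.real {x} ≤ 0 := ge_of_tendsto' hlim hbound
  exact (measureReal_eq_zero_iff).1 (le_antisymm h0 measureReal_nonneg)

/-! ### Relative recursiveness as continuous dependence on the name. -/

/-- A partial recursive function of a list and a number that is preserved when the list is
extended. -/
structure IsFunctional (F : List ℕ → ℕ →. ℕ) : Prop where
  partrec : Partrec₂ F
  mono : ∀ ⦃z z' : List ℕ⦄, z <+: z' → ∀ a b, b ∈ F z a → b ∈ F z' a

/-- The partial function `f` is obtained by applying `F` to the initial segments of `Z`. -/
def Realizes (F : List ℕ → ℕ →. ℕ) (Z : ℕ → ℕ) (f : ℕ →. ℕ) : Prop :=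
  ∀ a b, b ∈ f a ↔ ∃ s, b ∈ F (initial Z s) a

theorem IsFunctional.initial_mono {F : List ℕ → ℕ →. ℕ} (hF : IsFunctional F) {Z : ℕ → ℕ}
    {s s' : ℕ} (h : s ≤ s') {a b : ℕ} (hb : b ∈ F (initial Z s) a) : b ∈ F (initial Z s') a :=
  hF.mono (initial_prefix Z h) a b hb

theorem exists_functional_of_partrec {f : ℕ →. ℕ} (hf : Nat.Partrec f) (Z : ℕ → ℕ) :
    ∃ F, IsFunctional F ∧ Realizes F Z f :=
  ⟨fun _ a => f a, ⟨(Partrec.nat_iff.2 hf).comp Computable.snd, fun _ _ _ _ _ h => h⟩,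
    fun _ _ => ⟨fun h => ⟨0, h⟩, fun ⟨_, h⟩ => h⟩⟩

/-- Primitive recursion of partial functions. -/
def primRec (f h : ℕ →. ℕ) (a n : ℕ) : Part ℕ :=
  n.rec (f a) fun y IH => IH.bind fun i => h (Nat.pair a (Nat.pair y i))

theorem mem_primRec_succ {f h : ℕ →. ℕ} {a n b : ℕ} :
    b ∈ primRec f h a (n + 1) ↔ ∃ i ∈ primRec f h a n, b ∈ h (Nat.pair a (Nat.pair n i)) :=
  Part.mem_bind_iff

theorem primRec_mono {f h f' h' : ℕ →. ℕ} (hf : ∀ a b, b ∈ f a → b ∈ f' a)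
    (hh : ∀ a b, b ∈ h a → b ∈ h' a) (a n b : ℕ) (hb : b ∈ primRec f h a n) :
    b ∈ primRec f' h' a n := by
  induction n generalizing b with
  | zero => exact hf a b hb
  | succ n ih =>
    obtain ⟨i, hi, hb⟩ := mem_primRec_succ.1 hb
    exact mem_primRec_succ.2 ⟨i, ih i hi, hh _ _ hb⟩

/-- Minimization of a partial function. -/
def minimum (f : ℕ →. ℕ) (a : ℕ) : Part ℕ :=
  Nat.rfind fun n => (f (Nat.pair a n)).map fun m => decide (m = 0)

theorem mem_minimum {f : ℕ →. ℕ} {a b : ℕ} :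
    b ∈ minimum f a ↔ 0 ∈ f (Nat.pair a b) ∧ ∀ m < b, ∃ d ∈ f (Nat.pair a m), d ≠ 0 := by
  refine Nat.mem_rfind.trans (and_congr ?_ (forall_congr' fun m => imp_congr_right fun _ => ?_))
  · refine (Part.mem_map_iff _).trans ⟨?_, fun h => ⟨0, h, rfl⟩⟩
    rintro ⟨c, hc, h0⟩
    rwa [of_decide_eq_true h0] at hc
  · exact (Part.mem_map_iff _).trans
      (exists_congr fun d => and_congr_right fun _ => decide_eq_false_iff_not)

/-- Every partial function that is recursive in a function with a continuous name has a continuous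
name. -/
theorem exists_functional {Z : ℕ → ℕ} {g : ℕ →. ℕ}
    (hg : ∃ G, IsFunctional G ∧ Realizes G Z g) {f : ℕ →. ℕ} (hf : Nat.RecursiveIn {g} f) :
    ∃ F, IsFunctional F ∧ Realizes F Z f := by
  induction hf with
  | zero => exact exists_functional_of_partrec Nat.Partrec.zero Z
  | succ => exact exists_functional_of_partrec Nat.Partrec.succ Z
  | left => exact exists_functional_of_partrec Nat.Partrec.left Z
  | right => exact exists_functional_of_partrec Nat.Partrec.right Z
  | oracle g' h => rw [Set.mem_singleton_iff.1 h]; exact hg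
  | @pair f h _ _ ihf ihh =>
    obtain ⟨F, hF, hF'⟩ := ihf
    obtain ⟨H, hH, hH'⟩ := ihh
    refine ⟨fun z a => (F z a).bind fun b => (H z a).map fun c => Nat.pair b c, ⟨?_, ?_⟩, ?_⟩
    · refine Partrec.bind hF.partrec (Partrec.map (hH.partrec.comp
        (Computable.fst.comp Computable.fst) (Computable.snd.comp Computable.fst)) ?_)
      exact (Primrec₂.natPair.to_comp).comp (Computable.snd.comp Computable.fst) Computable.snd
    · intro z z' hz a b
      simp only [Part.mem_bind_iff, Part.mem_map_iff]
      rintro ⟨c, hc, d, hd, rfl⟩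
      exact ⟨c, hF.mono hz a c hc, d, hH.mono hz a d hd, rfl⟩
    · intro a b
      simp only [Seq.seq, Part.mem_bind_iff, Part.map_eq_map, Part.mem_map_iff]
      constructor
      · rintro ⟨_, ⟨c, hc, rfl⟩, d, hd, rfl⟩
        obtain ⟨s, hs⟩ := (hF' a c).1 hc
        obtain ⟨t, ht⟩ := (hH' a d).1 hd
        exact ⟨max s t, c, hF.initial_mono (le_max_left s t) hs, d,
          hH.initial_mono (le_max_right s t) ht, rfl⟩
      · rintro ⟨s, c, hc, d, hd, rfl⟩
        exact ⟨_, ⟨c, (hF' a c).2 ⟨s, hc⟩, rfl⟩, d, (hH' a d).2 ⟨s, hd⟩, rfl⟩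
  | @comp f h _ _ ihf ihh =>
    obtain ⟨F, hF, hF'⟩ := ihf
    obtain ⟨H, hH, hH'⟩ := ihh
    refine ⟨fun z a => (H z a).bind fun b => F z b, ⟨?_, ?_⟩, ?_⟩
    · exact Partrec.bind hH.partrec
        (hF.partrec.comp (Computable.fst.comp Computable.fst) Computable.snd)
    · intro z z' hz a b
      simp only [Part.mem_bind_iff]
      rintro ⟨c, hc, hb⟩
      exact ⟨c, hH.mono hz a c hc, hF.mono hz c b hb⟩
    · intro a b
      refine Part.mem_bind_iff.trans (Iff.trans ?_ (exists_congr fun s => Part.mem_bind_iff.symm))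
      constructor
      · rintro ⟨c, hc, hd⟩
        obtain ⟨s, hs⟩ := (hH' a c).1 hc
        obtain ⟨t, ht⟩ := (hF' c b).1 hd
        exact ⟨max s t, c, hH.initial_mono (le_max_left s t) hs,
          hF.initial_mono (le_max_right s t) ht⟩
      · rintro ⟨s, c, hc, hd⟩
        exact ⟨c, (hH' a c).2 ⟨s, hc⟩, (hF' c b).2 ⟨s, hd⟩⟩
  | @prec f h _ _ ihf ihh =>
    obtain ⟨F, hF, hF'⟩ := ihf
    obtain ⟨H, hH, hH'⟩ := ihh
    refine ⟨fun z p => primRec (F z) (H z) p.unpair.1 p.unpair.2,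
      ⟨?_, fun z z' hz p b hb => primRec_mono (hF.mono hz) (hH.mono hz) _ _ _ hb⟩, fun p b => ?_⟩
    · have h₁ : Partrec fun q : List ℕ × ℕ × ℕ => primRec (F q.1) (H q.1) q.2.1 q.2.2 := by
        refine Partrec.nat_rec (f := fun q : List ℕ × ℕ × ℕ => q.2.2) (g := fun q => F q.1 q.2.1)
          (h := fun q yi => H q.1 (Nat.pair q.2.1 (Nat.pair yi.1 yi.2)))
          (Computable.snd.comp Computable.snd)
          (hF.partrec.comp Computable.fst (Computable.fst.comp Computable.snd))
          (hH.partrec.comp (Computable.fst.comp Computable.fst) ?_)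
        exact Primrec₂.natPair.to_comp.comp
          (Computable.fst.comp (Computable.snd.comp Computable.fst))
          (Primrec₂.natPair.to_comp.comp (Computable.fst.comp Computable.snd)
            (Computable.snd.comp Computable.snd))
      exact h₁.comp (Computable.pair Computable.fst (Computable.unpair.comp Computable.snd))
    · change b ∈ primRec f h p.unpair.1 p.unpair.2 ↔ _
      change _ ↔ ∃ s, b ∈ primRec (F (initial Z s)) (H (initial Z s)) p.unpair.1 p.unpair.2
      generalize p.unpair.1 = a
      generalize p.unpair.2 = n
      induction n generalizing b with
      | zero => exact hF' a b
      | succ n ih =>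
        refine mem_primRec_succ.trans
          (Iff.trans ?_ (exists_congr fun s => mem_primRec_succ.symm))
        constructor
        · rintro ⟨i, hi, hb⟩
          obtain ⟨s, hs⟩ := (ih i).1 hi
          obtain ⟨t, ht⟩ := (hH' _ b).1 hb
          exact ⟨max s t, i, primRec_mono (hF.mono (initial_prefix Z (le_max_left s t)))
            (hH.mono (initial_prefix Z (le_max_left s t))) _ _ _ hs,
            hH.initial_mono (le_max_right s t) ht⟩
        · rintro ⟨s, i, hi, hb⟩
          exact ⟨i, (ih i).2 ⟨s, hi⟩, (hH' _ b).2 ⟨s, hb⟩⟩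
  | @rfind f _ ihf =>
    obtain ⟨F, hF, hF'⟩ := ihf
    refine ⟨fun z a => minimum (F z) a, ⟨?_, ?_⟩, fun a b => ?_⟩
    · refine Partrec.rfind (p := fun (q : List ℕ × ℕ) n =>
        (F q.1 (Nat.pair q.2 n)).map fun m => decide (m = 0)) ?_
      refine Partrec.map (hF.partrec.comp (Computable.fst.comp Computable.fst)
        (Primrec₂.natPair.to_comp.comp (Computable.snd.comp Computable.fst) Computable.snd)) ?_
      exact ((Primrec.eq.comp Primrec.snd (Primrec.const 0)).decide).to_comp
    · intro z z' hz a b hb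
      obtain ⟨h0, h⟩ := mem_minimum.1 hb
      refine mem_minimum.2 ⟨hF.mono hz _ _ h0, fun m hm => ?_⟩
      obtain ⟨d, hd, h1⟩ := h m hm
      exact ⟨d, hF.mono hz _ _ hd, h1⟩
    · refine Iff.trans (b := b ∈ minimum f a) Iff.rfl
        (mem_minimum.trans (Iff.trans ?_ (exists_congr fun s => mem_minimum.symm)))
      constructor
      · rintro ⟨h0, h⟩
        have h' : ∀ m < b, ∃ s, ∃ d ∈ F (initial Z s) (Nat.pair a m), d ≠ 0 := by
          intro m hm
          obtain ⟨d, hd, h1⟩ := h m hm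
          obtain ⟨s, hs⟩ := (hF' _ d).1 hd
          exact ⟨s, d, hs, h1⟩
        choose! S hS using h'
        obtain ⟨s, hs⟩ := (hF' _ 0).1 h0
        -- Minimization uses finitely many values, so one initial segment of `Z` suffices for all of
        -- them.
        refine ⟨max s ((Finset.range b).sup S), hF.initial_mono (le_max_left _ _) hs,
          fun m hm => ?_⟩
        obtain ⟨d, hd, h1⟩ := hS m hm
        exact ⟨d, hF.initial_mono ((Finset.le_sup (f := S) (Finset.mem_range.2 hm)).trans
          (le_max_right _ _)) hd, h1⟩
      · rintro ⟨s, h0, h⟩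
        refine ⟨(hF' _ 0).2 ⟨s, h0⟩, fun m hm => ?_⟩
        obtain ⟨d, hd, h1⟩ := h m hm
        exact ⟨d, (hF' _ d).2 ⟨s, hd⟩, h1⟩

/-! ### Tests enumerated from the name, and randomness of `x`. -/

/-- The string `σ` is enumerated at level `n` by the program `c` with the initial segments of `z`
as data, in at most `|z|` steps. -/
def enumBy (c : Nat.Partrec.Code) (n : ℕ) (z : List ℕ) (σ : List Bool) : Prop :=
  ∃ i ≤ z.length, (Nat.Partrec.Code.evaln z.length c
    (Encodable.encode (z.take i, Encodable.encode (n, σ)))).isSome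

/-- A computation that halts on a prefix of the table is still counted later, since `enumBy` ranges
over all prefixes; running the program on the whole table alone would not be monotone in the number
of steps. -/
theorem enumBy_increasing (c : Nat.Partrec.Code) (n : ℕ) : Increasing (enumBy c n) := by
  rintro z _ ⟨r, rfl⟩ σ ⟨i, hi, h⟩
  obtain ⟨b, hb⟩ := Option.isSome_iff_exists.1 h
  refine ⟨i, hi.trans (by simp), Option.isSome_iff_exists.2 ⟨b, ?_⟩⟩
  rw [List.take_append_of_le_length hi]
  exact Nat.Partrec.Code.evaln_mono (by simp) hb

theorem primrecRel_enumBy (c : Nat.Partrec.Code) (n : ℕ) : PrimrecRel (enumBy c n) := by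
  have h : PrimrecPred fun p : List ℕ × List Bool => ∃ i ∈ List.range (p.1.length + 1),
      (Nat.Partrec.Code.evaln p.1.length c
        (Encodable.encode (p.1.take i, Encodable.encode (n, p.2)))).isSome = true := by
    refine PrimrecRel.exists_mem
      (Primrec.list_range.comp (Primrec.succ.comp (Primrec.list_length.comp Primrec.fst))) ?_
    have hz : Primrec fun q : (List ℕ × List Bool) × ℕ => q.1.1 := Primrec.fst.comp Primrec.fst
    refine Primrec.eq.comp (Primrec.option_isSome.comp (Nat.Partrec.Code.primrec_evaln.comp
      (Primrec.pair (Primrec.pair (Primrec.list_length.comp hz) (Primrec.const c))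
        (Primrec.encode.comp (Primrec.pair (Primrec.list_take.comp Primrec.snd hz)
          (Primrec.encode.comp (Primrec.pair (Primrec.const n)
            (Primrec.snd.comp Primrec.fst)))))))) (Primrec.const true)
  refine h.of_eq fun p => exists_congr fun i => ?_
  rw [List.mem_range, Nat.lt_succ_iff]

/-- Every set that is recursively enumerable in a real with a continuous name is enumerated by
a program. -/
theorem exists_enumBy {Z : ℕ → ℕ} {ρ : Cantor}
    (hρ : ∃ G, IsFunctional G ∧ Realizes G Z (oracleOf ρ)) {W : Set (ℕ × List Bool)}
    (hW : IsREIn ρ W) :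
    ∃ c : Nat.Partrec.Code, ∀ n σ, (n, σ) ∈ W ↔ ∃ s, enumBy c n (initial Z s) σ := by
  obtain ⟨F, hF, hF'⟩ := exists_functional hρ hW
  obtain ⟨c, hc⟩ := Nat.Partrec.Code.exists_code.1 hF.partrec
  have hc' : ∀ z a b, b ∈ c.eval (Encodable.encode (z, a)) ↔ b ∈ F z a := by
    intro z a b
    rw [hc]
    simp
  refine ⟨c, fun n σ => ?_⟩
  have hdom : (n, σ) ∈ W ↔ ∃ s b, b ∈ F (initial Z s) (Encodable.encode (n, σ)) := by
    rw [exists_comm]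
    simp only [← hF' _ _]
    simp [Part.mem_assert_iff]
  rw [hdom]
  constructor
  · rintro ⟨s, b, hb⟩
    obtain ⟨k, hk⟩ := Nat.Partrec.Code.evaln_complete.1 ((hc' _ _ _).2 hb)
    refine ⟨max s k, s, by simp [length_initial], Option.isSome_iff_exists.2 ⟨b, ?_⟩⟩
    rw [take_initial Z (le_max_left s k), length_initial]
    exact Nat.Partrec.Code.evaln_mono (le_max_right s k) hk
  · rintro ⟨s, i, hi, h⟩
    obtain ⟨b, hb⟩ := Option.isSome_iff_exists.1 h
    rw [length_initial] at hi
    rw [take_initial Z hi] at hb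
    exact ⟨i, b, (hc' _ _ _).1 (Nat.Partrec.Code.evaln_sound hb)⟩

/-- The strings counted by `weight` form a finite subset of `S`, and their codes are below `s`,
where the table gives the exact measures. -/
theorem Names.weight_le {Z : ℕ → ℕ} {μ : Measure Cantor} [IsProbabilityMeasure μ]
    (hZ : Names Z μ) {E : List ℕ → List Bool → Prop} {s n : ℕ} {S : Set (List Bool)}
    (hE : ∀ σ, E (initial Z s) σ → σ ∈ S)
    (hS : ∑' σ : S, μ (cyl σ.1) ≤ (2 : ENNReal)⁻¹ ^ n) :
    weight E (initial Z s) * 2 ^ n ≤ 4 ^ (s + 1) := by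
  classical
  set T : Finset (List Bool) := ((strings s).toFinset).filter fun σ => E (initial Z s) σ with hT
  have h₁ : (weight E (initial Z s) : ℝ) = 4 ^ (s + 1) * ∑ σ ∈ T, μ.real (cyl σ) := by
    rw [weight, length_initial, ← List.sum_toFinset _ (nodup_strings s), Nat.cast_sum, hT,
      Finset.sum_filter, Finset.mul_sum]
    refine Finset.sum_congr rfl fun σ hσ => ?_
    have hσ' := mem_strings.1 (List.mem_toFinset.1 hσ)
    by_cases h : E (initial Z s) σ
    · have hl : σ.length ≤ s := (length_le_encode σ).trans hσ'.le
      obtain ⟨k, rfl⟩ := Nat.exists_eq_add_of_le hl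
      rw [if_pos h, if_pos h, massOf_initial Z hσ', hZ, Nat.add_sub_cancel_left]
      push_cast
      rw [show σ.length + k + 1 = k + (σ.length + 1) by ring, pow_add (4 : ℝ) k]
      field_simp
    · rw [if_neg h, if_neg h, Nat.cast_zero, mul_zero]
  have h₂ : ∑ σ ∈ T, μ (cyl σ) ≤ (2 : ENNReal)⁻¹ ^ n := by
    refine le_trans ?_ hS
    have hTS : ∀ σ ∈ T, σ ∈ S := fun σ hσ => hE σ (Finset.mem_filter.1 hσ).2
    calc ∑ σ ∈ T, μ (cyl σ) = ∑ σ ∈ T.subtype (· ∈ S), μ (cyl σ.1) := by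
          rw [Finset.sum_subtype_of_mem (fun σ => μ (cyl σ)) hTS]
      _ ≤ _ := ENNReal.sum_le_tsum _
  have h₃ : ∑ σ ∈ T, μ.real (cyl σ) ≤ (2 : ℝ)⁻¹ ^ n := by
    have := ENNReal.toReal_mono (by simp) h₂
    rw [ENNReal.toReal_sum fun σ _ => measure_ne_top μ _] at this
    simpa [Measure.real] using this
  have h₄ : (weight E (initial Z s) : ℝ) * 2 ^ n ≤ 4 ^ (s + 1) := by
    rw [h₁]
    calc 4 ^ (s + 1) * (∑ σ ∈ T, μ.real (cyl σ)) * 2 ^ n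
        ≤ 4 ^ (s + 1) * (2 : ℝ)⁻¹ ^ n * 2 ^ n := by gcongr
      _ = 4 ^ (s + 1) := by rw [mul_assoc, ← mul_pow]; norm_num
  exact_mod_cast h₄

/-- The test enumerated by the `k`-th program. -/
def enumTest (k : ℕ) : ℕ → List ℕ → List Bool → Prop :=
  enumBy (Denumerable.ofNat Nat.Partrec.Code k)

/-- For a correct test the side condition on `weight` in `Covered` holds at every stage. Failing the
test would thus mean being covered at every level, which is excluded at one of them. -/
theorem Names.isRandomFor {Z : ℕ → ℕ} {μ : Measure Cantor} [IsProbabilityMeasure μ]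
    (hZ : Names Z μ) {ρ : Cantor} (hρ : ∃ G, IsFunctional G ∧ Realizes G Z (oracleOf ρ))
    {x : Cantor}
    (hx : ∀ k, ∃ n, ∀ s j, ¬ Covered (enumTest k n) n (initial Z s) (pre x j)) :
    IsRandomFor ρ μ x := by
  intro W hW hcorr hfail
  obtain ⟨c, hc⟩ := exists_enumBy hρ hW
  obtain ⟨n, hn⟩ := hx (Encodable.encode c)
  rw [enumTest, Denumerable.ofNat_encode] at hn
  obtain ⟨σ, hσ, hxσ⟩ := Set.mem_iUnion₂.1 (Set.mem_iInter.1 hfail n)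
  obtain ⟨s, hs⟩ := (hc n σ).1 hσ
  -- At this stage `σ` has been enumerated and its code is below the length of the table.
  set s' := max s (Encodable.encode σ + 1) with hs'
  refine hn s' σ.length ⟨s', by rw [length_initial], ?_⟩
  rw [take_initial Z le_rfl]
  refine ⟨hZ.weight_le (fun τ hτ => (hc n τ).2 ⟨s', hτ⟩) (hcorr n), σ,
    mem_strings.2 (lt_of_lt_of_le (Nat.lt_succ_self _) (le_max_right _ _)),
    enumBy_increasing c n (initial_prefix Z (le_max_left _ _)) σ hs, ?_⟩
  rw [mem_cyl.1 hxσ]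

/-! ### Representations computed from the name. -/

/-- An oracle has a continuous name if its values are computed from initial segments of `Z` by a
primitive recursive function. -/
theorem exists_functional_oracleOf {Z : ℕ → ℕ} {ρ : Cantor} {G : List ℕ → ℕ → Option Bool}
    (hG : Primrec₂ G) (hmono : ∀ ⦃z z' : List ℕ⦄, z <+: z' → ∀ m b, b ∈ G z m → b ∈ G z' m)
    (hρ : ∀ m, ∃ s, ρ m ∈ G (initial Z s) m) :
    ∃ G, IsFunctional G ∧ Realizes G Z (oracleOf ρ) := by
  refine ⟨fun z m => ((G z m).map Bool.toNat : Option ℕ), ⟨?_, ?_⟩, fun m b => ?_⟩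
  · refine Computable.ofOption (Primrec.to_comp ?_)
    exact Primrec.option_map hG ((Primrec.dom_bool Bool.toNat).comp Primrec.snd)
  · intro z z' hz m b hb
    obtain ⟨c, hc, rfl⟩ := Option.mem_map.1 (Part.mem_ofOption.1 hb)
    exact Part.mem_ofOption.2 (Option.mem_map.2 ⟨c, hmono hz m c hc, rfl⟩)
  · obtain ⟨s, hs⟩ := hρ m
    constructor
    · intro hb
      obtain rfl := Part.mem_some_iff.1 hb
      exact ⟨s, Part.mem_ofOption.2 (Option.mem_map.2 ⟨_, hs, rfl⟩)⟩
    · rintro ⟨t, ht⟩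
      obtain ⟨c, hc, rfl⟩ := Option.mem_map.1 (Part.mem_ofOption.1 ht)
      have h₁ := hmono (initial_prefix Z (le_max_left s t)) m _ hs
      have h₂ := hmono (initial_prefix Z (le_max_right s t)) m _ hc
      rw [Option.mem_unique h₂ h₁]
      exact Part.mem_some _

/-- An oracle that is obtained from the numerators of the measure named by `Z` by a primitive
recursive relation has a continuous name. -/
theorem exists_functional_of_numer {Z : ℕ → ℕ} {ρ : Cantor} {α : Type*} [Primcodable α]
    {κ : α → List Bool} (hκ : Primrec κ) {R : ℕ → α → Prop} (hR : PrimrecRel R)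
    (hρ : ∀ m, ρ m = true ↔ ∃ t : α, m = Encodable.encode t ∧ R (numer Z (κ t)) t) :
    ∃ G, IsFunctional G ∧ Realizes G Z (oracleOf ρ) := by
  classical
  -- The answer is `false` if `m` codes nothing, and is withheld while the table is too short for
  -- the relevant numerator to be reliable.
  set G : List ℕ → ℕ → Option Bool := fun z m =>
    Option.casesOn (motive := fun _ => Option Bool) (Encodable.decode₂ α m) (some false) fun t =>
      if Encodable.encode (κ t) < z.length then some (decide (R (massOf z (κ t)) t)) else none
    with hG
  have hGprim : Primrec₂ G := by
    have hz : Primrec fun q : (List ℕ × ℕ) × α => q.1.1 := Primrec.fst.comp Primrec.fst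
    have hκ' : Primrec fun q : (List ℕ × ℕ) × α => κ q.2 := hκ.comp Primrec.snd
    have h₁ : Primrec₂ fun (p : List ℕ × ℕ) (t : α) =>
        if Encodable.encode (κ t) < p.1.length then some (decide (R (massOf p.1 (κ t)) t))
        else none :=
      Primrec.ite (Primrec.nat_lt.comp (Primrec.encode.comp hκ') (Primrec.list_length.comp hz))
        (Primrec.option_some.comp (hR.comp (primrec_massOf.comp hz hκ') Primrec.snd).decide)
        (Primrec.const none)
    exact Primrec.option_casesOn (Primrec.decode₂.comp Primrec.snd) (Primrec.const (some false)) h₁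
  refine exists_functional_oracleOf hGprim ?_ fun m => ?_
  · intro z z' hz m b hb
    simp only [hG] at hb ⊢
    cases h : Encodable.decode₂ α m with
    | none => rw [h] at hb; exact hb
    | some t =>
      rw [h] at hb
      simp only at hb ⊢
      split_ifs at hb with hlt
      · rw [if_pos (hlt.trans_le hz.length_le), ← massOf_of_prefix hz hlt]
        exact hb
      · simp at hb
  · cases h : Encodable.decode₂ α m with
    | none =>
      refine ⟨0, ?_⟩
      have : ρ m = false := by
        rw [Bool.eq_false_iff]
        intro hm
        obtain ⟨t, rfl, -⟩ := (hρ m).1 hm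
        simp at h
      simp [hG, h, this]
    | some t =>
      have hm := Encodable.mem_decode₂.1 h
      refine ⟨Encodable.encode (κ t) + 1, ?_⟩
      have : ρ m = decide (R (numer Z (κ t)) t) := by
        rw [Bool.eq_iff_iff, hρ, decide_eq_true_eq]
        constructor
        · rintro ⟨t', h', hR'⟩
          rw [← hm] at h'
          rwa [Encodable.encode_injective h']
        · exact fun hR' => ⟨t, hm.symm, hR'⟩
      simp only [hG, h, length_initial, Nat.lt_succ_self, if_true, Option.mem_def, this,
        massOf_initial Z (Nat.lt_succ_self _)]

theorem encode_int_ofNat (n : ℕ) : Encodable.encode (n : ℤ) = 2 * n := rfl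

theorem encode_int_negSucc (n : ℕ) : Encodable.encode (Int.negSucc n) = 2 * n + 1 := rfl

theorem primrec_int_toNat : Primrec Int.toNat := by
  refine (Primrec.ite (Primrec.eq.comp (Primrec.nat_mod.comp Primrec.encode (Primrec.const 2))
    (Primrec.const 0)) (Primrec.nat_div.comp Primrec.encode (Primrec.const 2))
    (Primrec.const 0)).of_eq fun a => ?_
  cases a with
  | ofNat n => rw [Int.ofNat_eq_natCast, encode_int_ofNat]; simp
  | negSucc n => rw [encode_int_negSucc]; simp

theorem primrecPred_int_neg : PrimrecPred fun a : ℤ => a < 0 := by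
  refine (Primrec.eq.comp (Primrec.nat_mod.comp Primrec.encode (Primrec.const 2))
    (Primrec.const 1)).of_eq fun a => ?_
  cases a with
  | ofNat n => rw [Int.ofNat_eq_natCast, encode_int_ofNat]; simp
  | negSucc n => rw [encode_int_negSucc]; simp [Int.negSucc_lt_zero]

/-- Cross-multiplication, with negative numerators set apart so that only arithmetic of natural
numbers remains. -/
theorem ratOf_lt_iff (p : ℤ × ℕ) (a k : ℕ) :
    ((ratOf p : ℝ) < (a : ℝ) / 4 ^ k) ↔ p.1 < 0 ∨ p.1.toNat * 4 ^ k < a * (p.2 + 1) := by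
  have h : ((ratOf p : ℝ) < (a : ℝ) / 4 ^ k) ↔ p.1 * 4 ^ k < (a : ℤ) * (p.2 + 1) := by
    rw [ratOf]
    push_cast
    rw [div_lt_div_iff₀ (by positivity) (by positivity)]
    exact_mod_cast Iff.rfl
  rw [h]
  rcases lt_or_ge p.1 0 with h0 | h0
  · refine iff_of_true ?_ (Or.inl h0)
    calc p.1 * 4 ^ k < 0 := mul_neg_of_neg_of_pos h0 (by positivity)
      _ ≤ _ := by positivity
  · rw [or_iff_right (not_lt.2 h0)]
    nth_rewrite 1 [← Int.toNat_of_nonneg h0]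
    exact_mod_cast Iff.rfl

theorem lt_ratOf_iff (p : ℤ × ℕ) (a k : ℕ) :
    ((a : ℝ) / 4 ^ k < (ratOf p : ℝ)) ↔ a * (p.2 + 1) < p.1.toNat * 4 ^ k := by
  have h : ((a : ℝ) / 4 ^ k < (ratOf p : ℝ)) ↔ (a : ℤ) * (p.2 + 1) < p.1 * 4 ^ k := by
    rw [ratOf]
    push_cast
    rw [div_lt_div_iff₀ (by positivity) (by positivity)]
    exact_mod_cast Iff.rfl
  rw [h]
  rcases lt_or_ge p.1 0 with h0 | h0
  · rw [Int.toNat_of_nonpos h0.le, zero_mul]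
    refine iff_of_false (not_lt.2 ?_) (Nat.not_lt_zero _)
    calc p.1 * 4 ^ k ≤ 0 := (mul_neg_of_neg_of_pos h0 (by positivity)).le
      _ ≤ _ := by positivity
  · nth_rewrite 1 [← Int.toNat_of_nonneg h0]
    exact_mod_cast Iff.rfl

/-- The values are exact fractions over 4^(|σ|+1), so strict comparison with a rational is decided
by finitely many entries of `Z`. -/
theorem Names.exists_rational {Z : ℕ → ℕ} {μ : Measure Cantor} (hZ : Names Z μ) :
    ∃ ρ : Cantor, IsRationalRepresentation ρ μ ∧
      ∃ G, IsFunctional G ∧ Realizes G Z (oracleOf ρ) := by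
  classical
  set R : ℕ → List Bool × (ℤ × ℕ) × (ℤ × ℕ) → Prop := fun a t =>
    (t.2.1.1 < 0 ∨ t.2.1.1.toNat * 4 ^ (t.1.length + 1) < a * (t.2.1.2 + 1)) ∧
      a * (t.2.2.2 + 1) < t.2.2.1.toNat * 4 ^ (t.1.length + 1) with hR
  have hRprim : PrimrecRel R := by
    have ht : Primrec fun p : ℕ × (List Bool × (ℤ × ℕ) × (ℤ × ℕ)) => p.2 := Primrec.snd
    have h4 : Primrec fun p : ℕ × (List Bool × (ℤ × ℕ) × (ℤ × ℕ)) => 4 ^ (p.2.1.length + 1) :=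
      primrec_nat_pow.comp (Primrec.const 4)
        (Primrec.succ.comp (Primrec.list_length.comp (Primrec.fst.comp ht)))
    have h1 := Primrec.fst.comp (Primrec.snd.comp ht)
    have h2 := Primrec.snd.comp (Primrec.snd.comp ht)
    exact ((primrecPred_int_neg.comp (Primrec.fst.comp h1)).or
      (Primrec.nat_lt.comp (Primrec.nat_mul.comp (primrec_int_toNat.comp (Primrec.fst.comp h1)) h4)
        (Primrec.nat_mul.comp Primrec.fst (Primrec.succ.comp (Primrec.snd.comp h1))))).and
      (Primrec.nat_lt.comp
        (Primrec.nat_mul.comp Primrec.fst (Primrec.succ.comp (Primrec.snd.comp h2)))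
        (Primrec.nat_mul.comp (primrec_int_toNat.comp (Primrec.fst.comp h2)) h4))
  refine ⟨fun m => decide (∃ t, m = Encodable.encode t ∧ R (numer Z t.1) t), fun m => ?_,
    exists_functional_of_numer Primrec.fst hRprim fun m => by rw [decide_eq_true_eq]⟩
  rw [decide_eq_true_eq]
  constructor
  · rintro ⟨⟨σ, q₁, q₂⟩, h, h₁, h₂⟩
    refine ⟨σ, q₁, q₂, h, ?_, ?_⟩
    · rw [hZ, ratOf_lt_iff]; exact h₁
    · rw [hZ, lt_ratOf_iff]; exact h₂
  · rintro ⟨σ, q₁, q₂, h, h₁, h₂⟩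
    rw [hZ, ratOf_lt_iff] at h₁
    rw [hZ, lt_ratOf_iff] at h₂
    exact ⟨(σ, q₁, q₂), h, h₁, h₂⟩

theorem numer_le (Z : ℕ → ℕ) (σ : List Bool) : numer Z σ ≤ 4 ^ (σ.length + 1) :=
  mass_le _ σ

theorem Names.exists_cauchy {Z : ℕ → ℕ} {μ : Measure Cantor} (hZ : Names Z μ) :
    ∃ ρ : Cantor, IsCauchyRepresentation ρ μ ∧
      ∃ G, IsFunctional G ∧ Realizes G Z (oracleOf ρ) := by
  classical
  set R : ℕ → List Bool × ℕ × ℕ → Prop := fun a t =>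
    t.2.2 = a * 2 ^ t.2.1 / 4 ^ (t.1.length + 1) with hR
  have hRprim : PrimrecRel R := by
    have ht : Primrec fun p : ℕ × (List Bool × ℕ × ℕ) => p.2 := Primrec.snd
    exact Primrec.eq.comp (Primrec.snd.comp (Primrec.snd.comp ht))
      (Primrec.nat_div.comp (Primrec.nat_mul.comp Primrec.fst
        (primrec_nat_pow.comp (Primrec.const 2) (Primrec.fst.comp (Primrec.snd.comp ht))))
        (primrec_nat_pow.comp (Primrec.const 4)
          (Primrec.succ.comp (Primrec.list_length.comp (Primrec.fst.comp ht)))))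
  -- The approximation to precision n is the integer part of 2ⁿ times the measure.
  refine ⟨fun m => decide (∃ t, m = Encodable.encode t ∧ R (numer Z t.1) t),
    ⟨fun σ n => numer Z σ * 2 ^ n / 4 ^ (σ.length + 1), fun σ n => ⟨?_, ?_⟩, fun m => ?_⟩,
    exists_functional_of_numer Primrec.fst hRprim fun m => by rw [decide_eq_true_eq]⟩
  · exact Nat.div_le_of_le_mul (Nat.mul_le_mul_right _ (numer_le Z σ))
  · have hd : (0 : ℝ) < 4 ^ (σ.length + 1) := by positivity
    have hp : (0 : ℝ) < 2 ^ n := by positivity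
    have h₁ : ((numer Z σ * 2 ^ n / 4 ^ (σ.length + 1) : ℕ) : ℝ) * 4 ^ (σ.length + 1) ≤
        numer Z σ * 2 ^ n := by
      exact_mod_cast Nat.div_mul_le_self (numer Z σ * 2 ^ n) (4 ^ (σ.length + 1))
    have h₂ : (numer Z σ : ℝ) * 2 ^ n <
        ((numer Z σ * 2 ^ n / 4 ^ (σ.length + 1) : ℕ) + 1) * 4 ^ (σ.length + 1) := by
      exact_mod_cast (Nat.div_lt_iff_lt_mul (by positivity)).1
        (Nat.lt_succ_self (numer Z σ * 2 ^ n / 4 ^ (σ.length + 1)))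
    set q : ℝ := ((numer Z σ * 2 ^ n / 4 ^ (σ.length + 1) : ℕ) : ℝ)
    have h₃ : q ≤ numer Z σ * 2 ^ n / 4 ^ (σ.length + 1) := (le_div_iff₀ hd).2 h₁
    have h₄ : (numer Z σ : ℝ) * 2 ^ n / 4 ^ (σ.length + 1) < q + 1 := (div_lt_iff₀ hd).2 h₂
    have e : (numer Z σ : ℝ) / 4 ^ (σ.length + 1) =
        numer Z σ * 2 ^ n / 4 ^ (σ.length + 1) / 2 ^ n := by field_simp
    rw [hZ, e, ← sub_div, abs_div, abs_of_pos hp]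
    gcongr
    rw [abs_le]
    constructor <;> linarith
  · rw [decide_eq_true_eq]
    constructor
    · rintro ⟨⟨σ, n, f⟩, h, hf⟩
      simp only [hR] at hf
      exact ⟨σ, n, by rw [h, hf]⟩
    · rintro ⟨σ, n, h⟩
      exact ⟨_, h, rfl⟩

/-- Every noncomputable real is random for a measure that has representations of both kinds
computable from the same name. -/
theorem exists_random {x : Cantor} (hx : ¬ Computable x) :
    ∃ (Z : ℕ → ℕ) (μ : ProbabilityMeasure Cantor), Names Z μ ∧ (μ : Measure Cantor) {x} = 0 ∧
      ∀ ρ : Cantor, (∃ G, IsFunctional G ∧ Realizes G Z (oracleOf ρ)) → IsRandomFor ρ μ x := by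
  obtain ⟨Z, h₁, h₂⟩ := exists_generic hx (E := enumTest)
    (fun _ n => enumBy_increasing _ n) (fun _ n => primrecRel_enumBy _ n)
  obtain ⟨μ, hμ⟩ := exists_names Z
  exact ⟨Z, μ, hμ, hμ.measure_singleton h₁, fun ρ hρ => hμ.isRandomFor hρ h₂⟩

/-! ### Computable reals are not random unless they are atoms. -/

/-- The set of pairs of `n` and `v k`, where `k` is the least number such that `ρ` answers the
query `q n k` positively. -/
def searchSet (ρ : Cantor) (q : ℕ → ℕ → ℕ) (v : ℕ → List Bool) : Set (ℕ × List Bool) :=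
  {p | ∃ k, ρ (q p.1 k) = true ∧ (∀ i < k, ρ (q p.1 i) = false) ∧ v k = p.2}

theorem isREIn_searchSet (ρ : Cantor) {q : ℕ → ℕ → ℕ} (hq : Computable₂ q) {v : ℕ → List Bool}
    (hv : Computable v) : IsREIn ρ (searchSet ρ q v) := by
  set d : ℕ → Option (ℕ × List Bool) := Encodable.decode with hd
  have hdec : Computable d := Computable.decode
  -- The default `(0, [])` for numbers that code nothing is harmless, since `C` diverges on them.
  set Q : ℕ → ℕ := fun p => q ((d p.unpair.1).getD (0, [])).1 p.unpair.2 with hQ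
  set C : ℕ → Option ℕ := fun p =>
    bif decide ((d p.unpair.2).map Prod.snd = some (v p.unpair.1)) then some 0 else none with hC
  have hquery : Nat.RecursiveIn {oracleOf ρ} fun p : ℕ => (Part.some (Q p) : Part ℕ) :=
    Nat.Partrec.recursiveIn (Partrec.nat_iff.1 (Computable.partrec (hq.comp
      (Computable.fst.comp (Computable.option_getD
        (hdec.comp (Computable.fst.comp Computable.unpair)) (Computable.const (0, []))))
      (Computable.snd.comp Computable.unpair))))
  have hneg : Nat.RecursiveIn {oracleOf ρ} fun b : ℕ => (Part.some (1 - b) : Part ℕ) :=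
    Nat.Partrec.recursiveIn (Partrec.nat_iff.1 (Computable.partrec
      ((Primrec.nat_sub.comp (Primrec.const 1) Primrec.id).to_comp)))
  have hid : Nat.RecursiveIn {oracleOf ρ} fun a : ℕ => (Part.some a : Part ℕ) :=
    Nat.Partrec.recursiveIn (Partrec.nat_iff.1 Computable.id.partrec)
  have hcheck : Nat.RecursiveIn {oracleOf ρ} fun p : ℕ => (C p : Part ℕ) := by
    refine Nat.Partrec.recursiveIn (Partrec.nat_iff.1 (Computable.ofOption ?_))
    have h₁ : Computable fun p : ℕ => decide ((d p.unpair.2).map Prod.snd = some (v p.unpair.1)) :=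
      Computable₂.comp (f := fun a b : Option (List Bool) => decide (a = b))
        (Primrec.eq.decide).to_comp
        (Computable.option_map (hdec.comp (Computable.snd.comp Computable.unpair))
          (Computable.snd.comp Computable.snd))
        (Computable.option_some.comp (hv.comp (Computable.fst.comp Computable.unpair)))
    exact Computable.cond h₁ (Computable.const (some 0)) (Computable.const none)
  -- Minimization looks for the value 0, so the answer of the oracle is negated.
  set A : ℕ →. ℕ := fun p => Part.some (1 - (ρ (Q p)).toNat) with hA
  have hA' : Nat.RecursiveIn {oracleOf ρ} A :=
    (hneg.comp ((Nat.RecursiveIn.oracle _ (Set.mem_singleton _)).comp hquery)).of_eq fun p =>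
      (congrArg (fun u : Part ℕ => u.bind fun b => Part.some (1 - b))
        (Part.bind_some (Q p) (oracleOf ρ))).trans (Part.bind_some _ _)
  have hmin : Nat.RecursiveIn {oracleOf ρ} (minimum A) := hA'.rfind
  have hall : Nat.RecursiveIn {oracleOf ρ}
      fun a => (minimum A a).bind fun k => (C (Nat.pair k a) : Part ℕ) :=
    (hcheck.comp (hmin.pair hid)).of_eq fun a => by
      refine Part.ext fun b => ?_
      simp only [Seq.seq, Part.bind_eq_bind, Part.map_eq_map, Part.mem_bind_iff, Part.mem_map_iff,
        Part.mem_some_iff]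
      constructor
      · rintro ⟨_, ⟨_, ⟨k, hk, rfl⟩, _, rfl, rfl⟩, hb⟩
        exact ⟨k, hk, hb⟩
      · rintro ⟨k, hk, hb⟩
        exact ⟨_, ⟨_, ⟨k, hk, rfl⟩, _, rfl, rfl⟩, hb⟩
  refine hall.of_eq fun a => Part.ext fun b => ?_
  have hmem : ∀ k, k ∈ minimum A a ↔ ρ (q ((d a).getD (0, [])).1 k) = true ∧
      ∀ i < k, ρ (q ((d a).getD (0, [])).1 i) = false := by
    intro k
    rw [mem_minimum]
    refine and_congr ?_ (forall₂_congr fun i _ => ?_)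
    · cases h : ρ (q ((d a).getD (0, [])).1 k) <;> simp [hA, hQ, h]
    · cases h : ρ (q ((d a).getD (0, [])).1 i) <;> simp [hA, hQ, h]
  rw [Part.mem_bind_iff]
  simp only [hmem]
  have ha : (Encodable.decode a : Option (ℕ × List Bool)) = d a := rfl
  rw [ha]
  cases h : d a with
  | none => simp [hC, h]
  | some p =>
    have hC' : ∀ k, b ∈ (C (Nat.pair k a) : Part ℕ) ↔ v k = p.2 ∧ b = 0 := by
      intro k
      by_cases hv : v k = p.2
      · simp [hC, h, hv, eq_comm]
      · simp [hC, h, hv, Ne.symm hv]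
    simp only [hC', Option.getD_some]
    have hR : b ∈ ((Part.some p).bind fun p => Part.map Encodable.encode
        (Part.assert (p ∈ searchSet ρ q v) fun _ => Part.some ())) ↔
        p ∈ searchSet ρ q v ∧ b = 0 := by
      simp only [Part.bind_some, Part.mem_map_iff, Part.mem_assert_iff, Part.mem_some_iff]
      exact ⟨fun ⟨_, ⟨h, _⟩, hb⟩ => ⟨h, hb.symm⟩, fun ⟨h, hb⟩ => ⟨(), ⟨h, trivial⟩, hb.symm⟩⟩
    refine Iff.trans ?_ hR.symm
    constructor
    · rintro ⟨k, ⟨h₁, h₂⟩, h₃, h₄⟩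
      exact ⟨⟨k, h₁, h₂, h₃⟩, h₄⟩
    · rintro ⟨⟨k, h₁, h₂, h₃⟩, h₄⟩
      exact ⟨k, ⟨h₁, h₂⟩, h₃, h₄⟩

theorem tendsto_measureReal_cyl (μ : Measure Cantor) [IsProbabilityMeasure μ] {x : Cantor}
    (hx : μ {x} = 0) : Filter.Tendsto (fun m => μ.real (cyl (pre x m))) Filter.atTop (nhds 0) := by
  have hanti : Antitone fun m => cyl (pre x m) := by
    intro m n h y hy
    rw [mem_cyl, length_pre] at hy ⊢
    have h₁ := List.prefix_iff_eq_take.1 (pre_prefix y h)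
    have h₂ := List.prefix_iff_eq_take.1 (pre_prefix x h)
    rw [length_pre] at h₁ h₂
    rw [h₁, h₂, hy]
  have hinter : ⋂ m, cyl (pre x m) = {x} := by
    ext y
    simp only [Set.mem_iInter, Set.mem_singleton_iff, mem_cyl, length_pre]
    refine ⟨fun h => funext fun i => ?_, fun h m => by rw [h]⟩
    have h₁ := getElem?_pre y (Nat.lt_succ_self i)
    rw [h, getElem?_pre x (Nat.lt_succ_self i)] at h₁
    exact (Option.some_injective _ h₁).symm
  have h := tendsto_measure_iInter_atTop (μ := μ)
    (fun m => (measurableSet_cyl (pre x m)).nullMeasurableSet) hanti ⟨0, measure_ne_top μ _⟩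
  rw [hinter, hx] at h
  exact (ENNReal.tendsto_toReal ENNReal.zero_ne_top).comp h

theorem measure_le_of_measureReal_le {μ : Measure Cantor} [IsProbabilityMeasure μ] {A : Set Cantor}
    {n : ℕ} (h : μ.real A ≤ (2 : ℝ)⁻¹ ^ n) : μ A ≤ (2 : ENNReal)⁻¹ ^ n := by
  rw [← ENNReal.toReal_le_toReal (measure_ne_top μ A) (by simp)]
  simpa [Measure.real] using h

/-- Only the least successful `k` contributes, so each section consists of one string and the sum
reduces to the measure of one cylinder around `x`. -/
theorem not_isRandomFor_of_search {ρ : Cantor} {μ : Measure Cantor} {x : Cantor}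
    {q : ℕ → ℕ → ℕ} (hq : Computable₂ q) {l : ℕ → ℕ} (hv : Computable fun k => pre x (l k))
    (hμ : ∀ n k, ρ (q n k) = true → μ (cyl (pre x (l k))) ≤ (2 : ENNReal)⁻¹ ^ n)
    (hex : ∀ n, ∃ k, ρ (q n k) = true) : ¬ IsRandomFor ρ μ x := by
  classical
  intro h
  refine h _ (isREIn_searchSet ρ hq hv) (fun n => ?_) (Set.mem_iInter.2 fun n => ?_)
  · have hsub : ∀ σ ∈ testSection (searchSet ρ q fun k => pre x (l k)) n,
        σ = pre x (l (Nat.find (hex n))) := by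
      rintro σ ⟨k, hk, hk', rfl⟩
      have : Nat.find (hex n) = k := (Nat.find_eq_iff _).2 ⟨hk, fun i hi => by simp [hk' i hi]⟩
      rw [this]
    have : Subsingleton (testSection (searchSet ρ q fun k => pre x (l k)) n) :=
      ⟨fun σ τ => Subtype.ext ((hsub _ σ.2).trans (hsub _ τ.2).symm)⟩
    rcases isEmpty_or_nonempty (testSection (searchSet ρ q fun k => pre x (l k)) n) with he | ⟨⟨σ⟩⟩
    · simp
    · rw [tsum_eq_single σ fun τ hτ => (hτ (Subsingleton.elim _ _)).elim, hsub _ σ.2]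
      exact hμ _ _ (Nat.find_spec (hex n))
  · refine Set.mem_iUnion₂.2 ⟨pre x (l (Nat.find (hex n))), ⟨_, Nat.find_spec (hex n),
      fun i hi => by simpa using Nat.find_min (hex n) hi, rfl⟩, ?_⟩
    rw [mem_cyl, length_pre]

theorem computable_pre {x : Cantor} (hx : Computable x) : Computable (pre x) := by
  have h : Computable fun n : ℕ => (n.rec [] fun m l => l ++ [x m] : List Bool) :=
    Computable.nat_rec (f := fun n => n) (g := fun _ => []) (h := fun _ p => p.2 ++ [x p.1])
      Computable.id (Computable.const [])
      (Computable₂.comp (f := fun (l : List Bool) b => l ++ [b]) Computable.list_concat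
        (Computable.snd.comp Computable.snd) (hx.comp (Computable.fst.comp Computable.snd)))
  refine h.of_eq fun n => ?_
  induction n with
  | zero => rfl
  | succ n ih => rw [pre_succ, ← ih]

theorem IsRationalRepresentation.not_isRandomFor {ρ : Cantor} {μ : Measure Cantor}
    [IsProbabilityMeasure μ] (hρ : IsRationalRepresentation ρ μ) {x : Cantor} (hx : Computable x)
    (h0 : μ {x} = 0) : ¬ IsRandomFor ρ μ x := by
  -- The lower bound -1 holds for every measure, and `(1, 2 ^ n - 1)` stands for 2⁻ⁿ because `ratOf`
  -- adds 1 to the denominator.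
  have hiff : ∀ n k, ρ (Encodable.encode (pre x k, (((-1 : ℤ), 0), ((1 : ℤ), 2 ^ n - 1)))) = true ↔
      μ.real (cyl (pre x k)) < (2 : ℝ)⁻¹ ^ n := by
    intro n k
    have hr : ((ratOf ((1 : ℤ), 2 ^ n - 1) : ℚ) : ℝ) = (2 : ℝ)⁻¹ ^ n := by
      have : ((2 ^ n - 1 : ℕ) : ℝ) + 1 = 2 ^ n := by
        rw [Nat.cast_sub Nat.one_le_two_pow]; simp
      rw [ratOf]
      push_cast [this]
      simp
    rw [hρ]
    constructor
    · rintro ⟨σ, q₁, q₂, h, -, h₂⟩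
      have := Encodable.encode_injective h
      simp only [Prod.mk.injEq] at this
      obtain ⟨rfl, rfl, rfl⟩ := this
      rwa [hr] at h₂
    · intro h
      refine ⟨_, _, _, rfl, ?_, by rwa [hr]⟩
      refine lt_of_lt_of_le ?_ measureReal_nonneg
      norm_num [ratOf]
  refine not_isRandomFor_of_search (l := id)
    (q := fun n k => Encodable.encode (pre x k, (((-1 : ℤ), 0), ((1 : ℤ), 2 ^ n - 1))))
    ?_ (computable_pre hx) (fun n k h => ?_) fun n => ?_
  · refine Computable.encode.comp (Computable.pair ((computable_pre hx).comp Computable.snd)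
      (Computable.pair (Computable.const _) (Computable.pair (Computable.const _) ?_)))
    exact (Primrec.nat_sub.comp (primrec_nat_pow.comp (Primrec.const 2) Primrec.fst)
      (Primrec.const 1)).to_comp
  · exact measure_le_of_measureReal_le ((hiff n k).1 h).le
  · obtain ⟨k, hk⟩ := ((tendsto_measureReal_cyl μ h0).eventually
      (gt_mem_nhds (show (0 : ℝ) < (2 : ℝ)⁻¹ ^ n by positivity))).exists
    exact ⟨k, (hiff n k).2 hk⟩

theorem IsCauchyRepresentation.not_isRandomFor {ρ : Cantor} {μ : Measure Cantor}
    [IsProbabilityMeasure μ] (hρ : IsCauchyRepresentation ρ μ) {x : Cantor} (hx : Computable x)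
    (h0 : μ {x} = 0) : ¬ IsRandomFor ρ μ x := by
  obtain ⟨f, hf, hρ⟩ := hρ
  have hiff : ∀ σ n i, ρ (Encodable.encode (σ, n, i)) = true ↔ i = f σ n := by
    intro σ n i
    rw [hρ]
    constructor
    · rintro ⟨σ', n', h⟩
      have := Encodable.encode_injective h
      simp only [Prod.mk.injEq] at this
      obtain ⟨rfl, rfl, rfl⟩ := this
      rfl
    · rintro rfl
      exact ⟨σ, n, rfl⟩
  -- The number `k` codes a length and a guess, capped at 1, for the approximation with precision n
  -- + 1. A correct guess bounds the measure by 2/2^(n+1) = 2⁻ⁿ.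
  refine not_isRandomFor_of_search (l := fun k => k.unpair.1)
    (q := fun n k => Encodable.encode (pre x k.unpair.1, n + 1, min k.unpair.2 1))
    ?_ ((computable_pre hx).comp (Computable.fst.comp Computable.unpair)) (fun n k h => ?_)
    fun n => ?_
  · exact Computable.encode.comp (Computable.pair
      ((computable_pre hx).comp (Computable.fst.comp (Computable.unpair.comp Computable.snd)))
      (Computable.pair (Computable.succ.comp Computable.fst)
        ((Primrec.nat_min.comp (Primrec.snd.comp (Primrec.unpair.comp Primrec.snd))
          (Primrec.const 1)).to_comp)))
  · rw [hiff] at h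
    have h₁ := (abs_le.1 (hf (pre x k.unpair.1) (n + 1)).2).1
    rw [← h] at h₁
    refine measure_le_of_measureReal_le ?_
    have h₂ : ((min k.unpair.2 1 : ℕ) : ℝ) ≤ 1 := by exact_mod_cast min_le_right _ _
    have h₃ : ((min k.unpair.2 1 : ℕ) : ℝ) / 2 ^ (n + 1) ≤ 1 / 2 ^ (n + 1) := by gcongr
    have e : (1 : ℝ) / 2 ^ (n + 1) + 1 / 2 ^ (n + 1) = (2 : ℝ)⁻¹ ^ n := by
      rw [pow_succ, inv_pow]; field_simp; norm_num
    linarith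
  -- Once the measure is below 1/2^(n+1), its approximating numerator is less than 2, so the cap
  -- does not change it.
  · obtain ⟨m, hm⟩ := ((tendsto_measureReal_cyl μ h0).eventually
      (gt_mem_nhds (show (0 : ℝ) < 1 / 2 ^ (n + 1) by positivity))).exists
    have h₁ := (abs_le.1 (hf (pre x m) (n + 1)).2).2
    have h₂ : (f (pre x m) (n + 1) : ℝ) / 2 ^ (n + 1) < 2 / 2 ^ (n + 1) := by
      have : (2 : ℝ) / 2 ^ (n + 1) = 1 / 2 ^ (n + 1) + 1 / 2 ^ (n + 1) := by ring
      linarith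
    have h₃ : (f (pre x m) (n + 1) : ℝ) < 2 := (div_lt_div_iff_of_pos_right (by positivity)).1 h₂
    have h₄ : f (pre x m) (n + 1) ≤ 1 := Nat.lt_succ_iff.1 (by exact_mod_cast h₃)
    refine ⟨Nat.pair m (f (pre x m) (n + 1)), ?_⟩
    simp only [Nat.unpair_pair]
    rw [hiff, min_eq_left h₄]

theorem mainTheorem1 (x : Cantor) :
    ((∃ (μ : ProbabilityMeasure Cantor) (ρ : Cantor),
        IsRationalRepresentation ρ (μ : Measure Cantor) ∧ (μ : Measure Cantor) {x} = 0 ∧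
          IsRandomFor ρ (μ : Measure Cantor) x) ↔ ¬ Computable x) ∧
    ((∃ (μ : ProbabilityMeasure Cantor) (ρ : Cantor),
        IsCauchyRepresentation ρ (μ : Measure Cantor) ∧ (μ : Measure Cantor) {x} = 0 ∧
          IsRandomFor ρ (μ : Measure Cantor) x) ↔ ¬ Computable x) := by
  refine ⟨⟨?_, fun hx => ?_⟩, ⟨?_, fun hx => ?_⟩⟩
  · rintro ⟨μ, ρ, hρ, h0, hr⟩ hx
    exact hρ.not_isRandomFor hx h0 hr
  · obtain ⟨Z, μ, hμ, h0, hr⟩ := exists_random hx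
    obtain ⟨ρ, hρ, hG⟩ := hμ.exists_rational
    exact ⟨μ, ρ, hρ, h0, hr ρ hG⟩
  · rintro ⟨μ, ρ, hρ, h0, hr⟩ hx
    exact hρ.not_isRandomFor hx h0 hr
  · obtain ⟨Z, μ, hμ, h0, hr⟩ := exists_random hx
    obtain ⟨ρ, hρ, hG⟩ := hμ.exists_cauchy
    exact ⟨μ, ρ, hρ, h0, hr ρ hG⟩
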